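/- **Setting.** Let $\mathcal X$ be a measurable space, $\mathcal Y=\{+1,-1\}$, and let $\mathcal D$ be a probability law on $\mathcal X\times\mathcal Y$ with marginal $\mathcal D_{\mathcal X}$ and conditional probability $\eta(x)=\mathbb P(y=+1\mid x)$ (a measurable version with values in $[0,1]$). Let $\mathcal F$ be a class of measurable functions $\mathcal X\to[0,1]$ that is pointwise measurable (some countable $\mathcal G\subseteq\mathcal F$ is such that each $f\in\mathcal F$ is the pointwise limit of a sequence in $\mathcal G$), and whose pseudo-dimension $d=\mathrm{Pdim}(\mathcal F)$, i.e. the VC dimension of $\{\{(x,\zeta): f(x)>\zeta\}: f\in\mathcal F\}$, satisfies $1\le d<\infty$. Assume a regression oracle that returns, for every finite list $S$ of labelled examples, some minimizer over $f\in\mathcal F$ of $\sum_{(x,y)\in S}(f(x)-\mathbb 1(y=+1))^2$. For $\widehat h:\mathcal X\to\{+1,-1,\bot\}$ let $\mathrm{err}_\gamma(\widehat h)=\mathbb P(\widehat h(x)\ne y,\widehat h(x)\ne\bot)+(\tfrac12-\gamma)\,\mathbb P(\widehat h(x)=\bot)$. Chow's excess error of $\widehat h$ is $\mathrm{err}_\gamma(\widehat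 h)-\mathbb P(h^\star(x)\neq y)$, where $h^\star$ is the Bayes classifier ($h^\star(x)=+1$ if and only if $\eta(x)\ge\frac12$). For $f_0\in\mathcal F$ and $\gamma_0,\varepsilon_0>0$ let $$\theta_{f_0}(\mathcal F,\gamma_0,\varepsilon_0)=\sup_{\mu}\ \sup_{\gamma'>\gamma_0,\ \varepsilon'>\varepsilon_0}\Big\{\tfrac{\gamma'^2}{\varepsilon'^2}\,\mu\big(\{x:\exists f\in\mathcal F,\ |f(x)-f_0(x)|>\gamma',\ \|f-f_0\|_{L^2(\mu)}\le\varepsilon'\}\big)\Big\}\vee 1,$$ where $\mu$ ranges over all probability measures on $\mathcal X$. **Algorithm** (inputs: $\varepsilon>0$, $\gamma\in(\varepsilon,\tfrac12)$, $\delta\in(0,1)$; numerical constant $c$). Put $T=\frac{d}{\varepsilon\gamma}$, $M=\lceil\log_2T\rceil$, $C_\delta=c\,d\log(T/\delta)$, $\tau_0=0$, $\tau_m=2^m$ for $m\ge1$, and $\beta_m=(M-m+1)(2\varepsilon^2\tau_{M-1}+2C_\delta)$. In epoch $m=1,\dots,M$: * let $S_m$ be the list of examples queried so far, let $L_m(f)=\sum_{(x,y)\in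 S_m}(f(x)-\mathbb 1(y=+1))^2$, and let $\widehat f_m$ be the minimizer of $L_m$ over $\mathcal F$ returned by the oracle; * let $\mathcal F_m=\{f\in\mathcal F: L_m(f)\le L_m(\widehat f_m)+\beta_m\}$, $\mathrm{lcb}_m(x)=\inf_{f\in\mathcal F_m}f(x)$ and $\mathrm{ucb}_m(x)=\sup_{f\in\mathcal F_m}f(x)$; * let $\widehat h_m(x)=\bot$ if $[\mathrm{lcb}_m(x),\mathrm{ucb}_m(x)]\subseteq[\frac12-\gamma,\frac12+\gamma]$, and otherwise $\widehat h_m(x)=\mathrm{sgn}(2\widehat f_m(x)-1)$, where a tie $\widehat f_m(x)=\frac12$ gives $-1$ if $\mathrm{ucb}_m(x)\le\frac12$ and $+1$ otherwise; * let $g_m(x)=1$ if $\frac12\in(\mathrm{lcb}_m(x),\mathrm{ucb}_m(x))$ and $\widehat h_m(x)\ne\bot$, and $g_m(x)=0$ otherwise; * if $m=M$, return $\widehat h_M$. Otherwise, for $t=\tau_{m-1}+1,\dots,\tau_m$, observe $x_t$, and query its label $y_t$ if and only if $g_m(x_t)=1$. Here $(x_1,y_1),(x_2,y_2),\dots$ are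 i.i.d. with law $\mathcal D$. It is assumed that all $\widehat h_m(x)$ and $g_m(x)$ are jointly measurable in the data and $x$. The label complexity is the number of queried labels. **Theorem.** There is a universal constant $c_0>0$ such that for every $c\ge c_0$ there is a constant $C>0$ depending only on $c$ with the following property. In the setting above, suppose that some $\bar f\in\mathcal F$ satisfies $\sup_x|\bar f(x)-\eta(x)|\le\kappa$ with $\kappa\le\varepsilon$ (the algorithm knows neither $\bar f$ nor $\kappa$), and put $\bar\theta=\sup_{\iota>0}\theta_{\bar f}(\mathcal F,\gamma/2,\iota)\in[1,\infty]$. Then with probability at least $1-2\delta$ both of the following hold: the returned classifier has Chow's excess error at most $$C\,\varepsilon\,\bar\theta\,\log\frac{d}{\varepsilon\gamma\delta},$$ and the label complexity is at most $$C\,\frac{\bar\theta\,d}{\gamma^2}\,\log^2\!\Big(\frac{d}{\varepsilon\gamma}\Big)\log\frac{d}{\varepsilon\gamma\delta}.$$ -/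

import Mathlib

open MeasureTheory Filter Topology
open scoped ENNReal

noncomputable section

namespace AbstainAL

/-! Labels are elements of `Bool`, with `true` for `+1` and `false` for `-1`.
Predictions of a classifier that may abstain are elements of `Option Bool`, with `none` for
abstention. -/

/-- The encoding of labels used in the squared loss: `+1` is encoded by `1` and `-1` by `0`, so that
the conditional mean of the encoded label given `x` is `η x`. -/
def labelValue (y : Bool) : ℝ := if y then 1 else 0

/-! ### The class of regression functions -/

section FunctionClass

variable {X : Type*}

/-- A family `𝒞` of sets shatters the finite set `S`. -/
def FamilyShatters {α : Type*} (𝒞 : Set (Set α)) (S : Finset α) : Prop :=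
  ∀ B ⊆ S, ∃ C ∈ 𝒞, ∀ p ∈ S, p ∈ C ↔ p ∈ B

/-- The VC dimension of a family of sets: the supremum of the cardinalities of shattered sets. -/
def familyVCDim {α : Type*} (𝒞 : Set (Set α)) : ℕ∞ :=
  ⨆ (S : Finset α) (_ : FamilyShatters 𝒞 S), (S.card : ℕ∞)

/-- The pseudo-dimension of `F`: the VC dimension of the family of the sets
`{(x, ζ) | f x > ζ}`, for `f ∈ F`. -/
def pdim (F : Set (X → ℝ)) : ℕ∞ :=
  familyVCDim {C : Set (X × ℝ) | ∃ f ∈ F, C = {p : X × ℝ | f p.1 > p.2}}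

/-- `F` is pointwise measurable (pointwise separable): it has a countable subset such that every
member of `F` is the pointwise limit of a sequence in that subset. -/
def PointwiseSeparable (F : Set (X → ℝ)) : Prop :=
  ∃ G ⊆ F, G.Countable ∧
    ∀ f ∈ F, ∃ u : ℕ → X → ℝ, (∀ n, u n ∈ G) ∧ ∀ x, Tendsto (fun n => u n x) atTop (𝓝 (f x))

/-- The value function disagreement coefficient of `F` at `f₀` with parameters `γ₀` and `ε₀`. -/
def valDisagreement [MeasurableSpace X] (F : Set (X → ℝ)) (f₀ : X → ℝ) (γ₀ ε₀ : ℝ) : ℝ≥0∞ :=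
  (⨆ (μ : Measure X) (_ : IsProbabilityMeasure μ) (γ : ℝ) (_ : γ₀ < γ) (ε : ℝ) (_ : ε₀ < ε),
    ENNReal.ofReal (γ ^ 2 / ε ^ 2) *
      μ {x | ∃ f ∈ F, γ < |f x - f₀ x| ∧ Real.sqrt (∫ z, (f z - f₀ z) ^ 2 ∂μ) ≤ ε}) ⊔ 1

/-- The supremum of the disagreement coefficient over all values `ι > 0` of the last parameter. -/
def valDisagreementSup [MeasurableSpace X] (F : Set (X → ℝ)) (f₀ : X → ℝ) (γ₀ : ℝ) : ℝ≥0∞ :=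
  ⨆ (ι : ℝ) (_ : 0 < ι), valDisagreement F f₀ γ₀ ι

/-- The squared loss of `f` on a finite list of labelled examples. -/
def sqLoss (f : X → ℝ) (S : List (X × Bool)) : ℝ :=
  (S.map fun p => (f p.1 - labelValue p.2) ^ 2).sum

/-- `oracle` is a regression oracle over `F`: for every finite list of labelled examples it returns
a minimizer over `F` of the squared loss. -/
def IsRegressionOracle (F : Set (X → ℝ)) (oracle : List (X × Bool) → X → ℝ) : Prop :=
  ∀ S, oracle S ∈ F ∧ ∀ f ∈ F, sqLoss (oracle S) S ≤ sqLoss f S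

/-- Lower confidence bound: the infimum of `f x` over `f` in the active set `A`. -/
def lcb (A : Set (X → ℝ)) (x : X) : ℝ := ⨅ f : A, (f : X → ℝ) x

/-- Upper confidence bound: the supremum of `f x` over `f` in the active set `A`. -/
def ucb (A : Set (X → ℝ)) (x : X) : ℝ := ⨆ f : A, (f : X → ℝ) x

end FunctionClass

/-! ### The algorithm -/

/-- Input of the algorithm: the class `F`, a regression oracle, the accuracy `ε`, the abstention
parameter `γ`, the confidence level `δ`, and the numerical constant `c` in the definition of
`C_δ`. -/
structure Input (X : Type*) where
  F : Set (X → ℝ)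
  oracle : List (X × Bool) → X → ℝ
  ε : ℝ
  γ : ℝ
  δ : ℝ
  c : ℝ

/-- `τ 0 = 0` and `τ m = 2 ^ m` for `m ≥ 1`. -/
def tau (m : ℕ) : ℕ := if m = 0 then 0 else 2 ^ m

namespace Input

variable {X : Type*} (I : Input X)

/-- The pseudo-dimension as a real number (used for classes of finite pseudo-dimension). -/
def d : ℝ := ((pdim I.F).toNat : ℝ)

def T : ℝ := I.d / (I.ε * I.γ)

/-- The number of epochs. -/
def M : ℕ := ⌈Real.logb 2 I.T⌉₊

def Cδ : ℝ := I.c * (I.d * Real.log (I.T / I.δ))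

/-- The elimination thresholds `β m`. -/
def β (m : ℕ) : ℝ :=
  ((I.M : ℝ) - (m : ℝ) + 1) * (2 * I.ε ^ 2 * (tau (I.M - 1) : ℝ) + 2 * I.Cδ)

/-- The active set when the labelled examples are `S` and the threshold is `b`. -/
def activeSet (S : List (X × Bool)) (b : ℝ) : Set (X → ℝ) :=
  {f | f ∈ I.F ∧ sqLoss f S ≤ sqLoss (I.oracle S) S + b}

open Classical in
/-- The classifier built from the labelled examples `S` with threshold `b`. It abstains if the
confidence interval is contained in `[1/2 - γ, 1/2 + γ]`, and otherwise predicts the sign of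
`2 f̂ - 1`, where `f̂ = oracle S`. A tie `f̂ x = 1/2` is broken towards the confidence interval: the
prediction is then `-1` if the confidence interval lies in `(-∞, 1/2]`, and `+1` otherwise. -/
def classifier (S : List (X × Bool)) (b : ℝ) (x : X) : Option Bool :=
  if Set.Icc (lcb (I.activeSet S b) x) (ucb (I.activeSet S b) x) ⊆
      Set.Icc (1 / 2 - I.γ) (1 / 2 + I.γ) then none
  else if 1 / 2 < I.oracle S x then some true
  else if I.oracle S x < 1 / 2 then some false
  else if ucb (I.activeSet S b) x ≤ 1 / 2 then some false
  else some true

open Classical in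
/-- The query function built from the labelled examples `S` with threshold `b`. -/
def query (S : List (X × Bool)) (b : ℝ) (x : X) : Bool :=
  decide ((1 / 2 : ℝ) ∈ Set.Ioo (lcb (I.activeSet S b) x) (ucb (I.activeSet S b) x) ∧
    I.classifier S b x ≠ none)

/-- The list of the examples whose label has been queried during epochs `1, …, m`, along the data
sequence `z`. The `t`-th data point of the sequence (`t = 1, 2, …`) is `z (t - 1)`, so epoch `m + 1`
processes `z (τ m), …, z (τ (m + 1) - 1)`; a data point enters the list exactly if the query
function of the epoch is `1` at its first component. Labels that are not queried are never used. -/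
def history : ℕ → (ℕ → X × Bool) → List (X × Bool)
  | 0, _ => []
  | m + 1, z =>
    history m z ++
      ((List.range' (tau m) (tau (m + 1) - tau m)).map z).filter
        (fun p => I.query (history m z) (I.β (m + 1)) p.1)

/-- The classifier `ĥ m` of epoch `m ≥ 1`. -/
def epochClassifier (m : ℕ) (z : ℕ → X × Bool) : X → Option Bool :=
  I.classifier (I.history (m - 1) z) (I.β m)

/-- The query function `g m` of epoch `m ≥ 1`. -/
def epochQuery (m : ℕ) (z : ℕ → X × Bool) : X → Bool :=
  I.query (I.history (m - 1) z) (I.β m)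

/-- The classifier `ĥ M` returned by the algorithm. -/
def output (z : ℕ → X × Bool) : X → Option Bool := I.epochClassifier I.M z

/-- The number of labels queried by the algorithm, which returns before sampling in epoch `M`. -/
def labelCount (z : ℕ → X × Bool) : ℕ := (I.history (I.M - 1) z).length

/-- The classifiers and query functions are jointly measurable in the data and the point. -/
def IsMeasurableRun [MeasurableSpace X] : Prop :=
  ∀ m, 1 ≤ m → m ≤ I.M →
    Measurable (fun p : (ℕ → X × Bool) × X => I.epochQuery m p.1 p.2) ∧
    @Measurable _ _ _ ⊤ (fun p : (ℕ → X × Bool) × X => I.epochClassifier m p.1 p.2)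

end Input

/-! ### Errors -/

section Errors

variable {X : Type*} [MeasurableSpace X]

/-- `η` is the conditional probability of the label `+1` given `x`, under the joint law `D`. -/
def IsCondProb (D : Measure (X × Bool)) (η : X → ℝ) : Prop :=
  Measurable η ∧ (∀ x, η x ∈ Set.Icc (0 : ℝ) 1) ∧
    ∀ A : Set X, MeasurableSet A →
      D (A ×ˢ {true}) = ∫⁻ x in A, ENNReal.ofReal (η x) ∂D.fst

/-- The standard error of a classifier. -/
def err (D : Measure (X × Bool)) (h : X → Bool) : ℝ := D.real {p | h p.1 ≠ p.2}

/-- Chow's error, with parameter `γ`, of a classifier that may abstain. -/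
def chowErr (D : Measure (X × Bool)) (γ : ℝ) (h : X → Option Bool) : ℝ :=
  D.real {p | h p.1 ≠ some p.2 ∧ h p.1 ≠ none} + (1 / 2 - γ) * D.real {p | h p.1 = none}

open Classical in
/-- The Bayes classifier, which predicts the sign of `2 η - 1`. -/
def bayes (η : X → ℝ) (x : X) : Bool := decide (1 / 2 ≤ η x)

/-- Chow's excess error: Chow's error minus the standard error of the Bayes classifier. -/
def chowExcess (D : Measure (X × Bool)) (η : X → ℝ) (γ : ℝ) (h : X → Option Bool) : ℝ :=
  chowErr D γ h - err D (bayes η)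

end Errors

end AbstainAL

end

/-! Write `g` for the approximating function `fbar`. On a queried point the excess loss of `f` over
`g` is `(f - g)^2`, plus a misspecification term `2(f - g)(g - η)`, minus the label noise `2(f -
g)(y - η)`. Half of the square absorbs the noise and a quarter absorbs the misspecification at a
cost of at most `4κ²` per point. So one quarter of the empirical squared distance to `g` is at most
the loss difference plus `C_δ`, uniformly over the class (`Controlled`).

Two uniform deviation bounds are needed. Label noise: given all points, the labels are independent
and each query decision depends only on points and earlier labels, so each function of a finite net
on the points gives an exponential supermartingale (`measure_noise_gt_le`). Sampling: the query
function of an epoch is fixed before its data are seen, so symmetrization with a ghost sample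
compares empirical and mean squared distances up to a factor 2 (`measure_ghost_gt_le`). Both nets
come from the Sauer-Shelah lemma, and both averagings go through `lintegral_le_of_cover`. The query
count needs only a scalar supermartingale (`measure_count_gt_le`).

On the good event the rest is deterministic. The function `g` is never eliminated, and the active
sets and query regions are nested because `β` drops by at least `2 C_δ` per epoch. Hence every
active `f` has mean squared distance to `g` of order `β / τ` on the query region. A queried point
has a confidence interval containing `1/2` and longer than `γ`, so some active `f` is further than
`γ / 2` from `g` there. Conditioning the marginal law on the query region and testing the
disagreement coefficient with that law bounds the probability of the region by a multiple of `θ β /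
(τ γ²)`.

Labels: an epoch of length about `τ` costs about `θ β / γ²`; summing over `M` epochs with `β ≤ β 1`,
itself proportional to `M`, gives the squared logarithm. Error: outside the query region the
classifier loses at most `2κ`; inside it loses at most `2κ + 2|f - g|`, with `f` the oracle output.
The integral of the last term is of order `θ β_M / (τ γ)`, hence of order `ε θ` times one logarithm,
since `β_M` carries no factor `M`. -/

namespace AbstainAL

/-! ### Finite uniform covers from the pseudo-dimension. -/

theorem sum_choose_le_add_one_pow (n d : ℕ) :
    ∑ k ∈ Finset.range (d + 1), n.choose k ≤ (n + 1) ^ d := by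
  induction d with
  | zero => simp
  | succ d ih =>
    rw [Finset.sum_range_succ]
    have h1 : n.choose (d + 1) ≤ n * (n + 1) ^ d :=
      calc n.choose (d + 1) ≤ n ^ (d + 1) := Nat.choose_le_pow n (d + 1)
        _ = n * n ^ d := by ring
        _ ≤ n * (n + 1) ^ d := by gcongr; omega
    calc _ ≤ (n + 1) ^ d + n * (n + 1) ^ d := Nat.add_le_add ih h1
      _ = (n + 1) ^ (d + 1) := by ring

/-- Sauer-Shelah in Pajor's form: a family has at most as many members as it has shattered sets, and
these have at most `d` elements. -/
theorem card_le_of_shatters_card_le {α : Type*} [DecidableEq α] (P : Finset α)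
    (𝒜 : Finset (Finset α)) (h𝒜 : ∀ s ∈ 𝒜, s ⊆ P) (d : ℕ)
    (hd : ∀ s, 𝒜.Shatters s → s.card ≤ d) : 𝒜.card ≤ (P.card + 1) ^ d := by
  refine le_trans (Finset.card_le_card_shatterer 𝒜) (le_trans ?_ (sum_choose_le_add_one_pow _ d))
  simp_rw [← Finset.card_powersetCard]
  refine (Finset.card_le_card fun s hs => Finset.mem_biUnion.2 ⟨s.card, ?_⟩).trans
    Finset.card_biUnion_le
  rw [Finset.mem_shatterer] at hs
  refine ⟨Finset.mem_range.2 (Nat.lt_succ_of_le (hd s hs)), Finset.mem_powersetCard.2 ⟨?_, rfl⟩⟩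
  obtain ⟨t, ht, hst⟩ := hs.exists_superset
  exact hst.trans (h𝒜 t ht)

/-- The subgraphs are traced on the grid of points of `A` and heights `k / K`. There are
polynomially many traces, two functions with the same trace differ by at most `1 / K` on `A`, and
one representative per trace forms the cover. -/
theorem exists_uniform_cover {X : Type*} {F : Set (X → ℝ)}
    (hF : ∀ f ∈ F, ∀ x, f x ∈ Set.Icc (0 : ℝ) 1) {d : ℕ} (hd : pdim F = d)
    (A : Finset X) {K : ℕ} (hK : 0 < K) :
    ∃ J : Finset (X → ℝ), (∀ g ∈ J, g ∈ F) ∧ J.card ≤ (A.card * K + 1) ^ d ∧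
      ∀ f ∈ F, ∃ g ∈ J, ∀ x ∈ A, |f x - g x| ≤ 1 / K := by
  classical
  set P : Finset (X × ℝ) := A ×ˢ ((Finset.range K).image fun k : ℕ => (k : ℝ) / K) with hP
  have hPc : P.card ≤ A.card * K := by
    rw [hP, Finset.card_product]
    gcongr
    simpa using Finset.card_image_le (s := Finset.range K) (f := fun k : ℕ => (k : ℝ) / K)
  let tr : (X → ℝ) → Finset (X × ℝ) := fun f => P.filter fun p => p.2 < f p.1
  set 𝒜 : Finset (Finset (X × ℝ)) := P.powerset.filter fun s => ∃ f ∈ F, tr f = s with h𝒜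
  have hrep : ∀ s ∈ 𝒜, ∃ f ∈ F, tr f = s := fun s hs => (Finset.mem_filter.1 hs).2
  choose! rep hrepF hrept using hrep
  have htr : ∀ f ∈ F, tr f ∈ 𝒜 := fun f hf =>
    Finset.mem_filter.2 ⟨Finset.mem_powerset.2 (Finset.filter_subset _ _), f, hf, rfl⟩
  refine ⟨𝒜.image rep, ?_, ?_, ?_⟩
  · intro g hg
    obtain ⟨s, hs, rfl⟩ := Finset.mem_image.1 hg
    exact hrepF s hs
  · refine Finset.card_image_le.trans (le_trans (card_le_of_shatters_card_le P 𝒜 ?_ d ?_) ?_)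
    · exact fun s hs => Finset.mem_powerset.1 (Finset.mem_filter.1 hs).1
    · intro s hs
      have hsP : s ⊆ P := by
        obtain ⟨t, ht, hst⟩ := hs.exists_superset
        exact hst.trans (Finset.mem_powerset.1 (Finset.mem_filter.1 ht).1)
      have hsh : FamilyShatters {C : Set (X × ℝ) | ∃ f ∈ F, C = {p : X × ℝ | f p.1 > p.2}} s := by
        intro B hB
        obtain ⟨t, ht, hst⟩ := hs hB
        refine ⟨_, ⟨rep t, hrepF t ht, rfl⟩, fun p hp => ?_⟩
        have h1 : p ∈ B ↔ p ∈ t := by rw [← hst]; simp [hp]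
        rw [h1]
        conv_rhs => rw [← hrept t ht]
        simp [tr, hsP hp]
      have h2 : (s.card : ℕ∞) ≤ pdim F :=
        le_iSup₂_of_le (f := fun (S : Finset (X × ℝ)) (_ : FamilyShatters _ S) => (S.card : ℕ∞))
          s hsh le_rfl
      rw [hd] at h2
      exact_mod_cast h2
    · gcongr
  · intro f hf
    refine ⟨rep (tr f), Finset.mem_image_of_mem _ (htr f hf), ?_⟩
    have key : ∀ f₁ ∈ F, ∀ f₂ ∈ F, tr f₁ = tr f₂ → ∀ x ∈ A, f₁ x - f₂ x ≤ 1 / K := by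
      intro f₁ h₁ f₂ h₂ h12 x hx
      by_contra! hlt
      have hK' : (0 : ℝ) < K := by exact_mod_cast hK
      have hb1 := (hF f₁ h₁ x).2
      have hb2 := (hF f₂ h₂ x).1
      have hlt' : (K : ℝ) * f₂ x + 1 < K * f₁ x := by
        have := mul_lt_mul_of_pos_left hlt hK'
        rw [mul_one_div_cancel hK'.ne'] at this
        linarith
      have hc1 : (⌈(K : ℝ) * f₂ x⌉₊ : ℝ) < K * f₂ x + 1 := Nat.ceil_lt_add_one (by positivity)
      have hc2 : (K : ℝ) * f₂ x ≤ ⌈(K : ℝ) * f₂ x⌉₊ := Nat.le_ceil _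
      -- The height `k / K` lies in `[f₂ x, f₁ x)`, so the grid point at this height separates the
      -- two traces.
      set k := ⌈(K : ℝ) * f₂ x⌉₊
      have hkK : k < K := by
        have : (k : ℝ) < K := by nlinarith
        exact_mod_cast this
      have hmem : (x, (k : ℝ) / K) ∈ P := by
        rw [hP, Finset.mem_product]
        exact ⟨hx, Finset.mem_image_of_mem _ (Finset.mem_range.2 hkK)⟩
      have h1 : (x, (k : ℝ) / K) ∈ tr f₁ := by
        refine Finset.mem_filter.2 ⟨hmem, ?_⟩
        rw [div_lt_iff₀ hK']
        linarith
      rw [h12] at h1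
      have h3 := (Finset.mem_filter.1 h1).2
      simp only at h3
      rw [div_lt_iff₀ hK'] at h3
      linarith
    intro x hx
    have ht := hrept _ (htr f hf)
    have hm := hrepF _ (htr f hf)
    rw [abs_le]
    constructor
    · have := key _ hm _ hf ht x hx
      linarith
    · exact key _ hf _ hm ht.symm x hx

/-! ### Invariances of the product law and averaging over covers. -/

section Product

variable {Z : Type*} [MeasurableSpace Z] (D : Measure Z) [IsProbabilityMeasure D]

theorem measurable_update_const (t : ℕ) :
    Measurable fun p : (ℕ → Z) × Z => Function.update p.1 t p.2 := by
  refine measurable_pi_iff.2 fun i => ?_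
  by_cases hi : i = t
  · subst hi; simpa using measurable_snd
  · simp only [Function.update_of_ne hi]; fun_prop

theorem map_update_infinitePi (t : ℕ) :
    ((Measure.infinitePi fun _ : ℕ => D).prod D).map
      (fun p : (ℕ → Z) × Z => Function.update p.1 t p.2) = Measure.infinitePi fun _ : ℕ => D := by
  classical
  refine Measure.eq_infinitePi _ fun s A hA => ?_
  rw [Measure.map_apply (measurable_update_const t) (.pi s.countable_toSet fun i _ => hA i)]
  have hpre : (fun p : (ℕ → Z) × Z => Function.update p.1 t p.2) ⁻¹' (s : Set ℕ).pi A =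
      ((s.erase t : Finset ℕ) : Set ℕ).pi A ×ˢ (if t ∈ s then A t else Set.univ) := by
    ext p
    simp only [Set.mem_preimage, Set.mem_pi, Set.mem_prod, Finset.mem_coe, Finset.mem_erase]
    constructor
    · intro h
      refine ⟨fun i hi => by simpa [hi.1] using h i hi.2, ?_⟩
      split_ifs with hts
      · simpa using h t hts
      · trivial
    · rintro ⟨h1, h2⟩ i hi
      by_cases hit : i = t
      · subst hit; simpa [hi] using h2
      · simpa [hit] using h1 i ⟨hit, hi⟩
  rw [hpre, Measure.prod_prod, Measure.infinitePi_pi _ fun i _ => hA i]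
  split_ifs with hts
  · rw [Finset.prod_erase_mul _ _ hts]
  · rw [Finset.erase_eq_of_notMem hts, measure_univ, mul_one]

/-- Plays the role of conditional expectation given all coordinates but one. -/
theorem lintegral_resample (t : ℕ) {Φ : (ℕ → Z) → ℝ≥0∞} (hΦ : Measurable Φ) :
    ∫⁻ z, ∫⁻ w, Φ (Function.update z t w) ∂D ∂(Measure.infinitePi fun _ : ℕ => D) =
      ∫⁻ z, Φ z ∂(Measure.infinitePi fun _ : ℕ => D) := by
  conv_rhs => rw [← map_update_infinitePi D t]
  rw [lintegral_map hΦ (measurable_update_const t), lintegral_prod]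
  exact (hΦ.comp (measurable_update_const t)).aemeasurable

theorem lintegral_perm (e : Equiv.Perm ℕ) {Φ : (ℕ → Z) → ℝ≥0∞} (hΦ : Measurable Φ) :
    ∫⁻ z, Φ (fun i => z (e i)) ∂(Measure.infinitePi fun _ : ℕ => D) =
      ∫⁻ z, Φ z ∂(Measure.infinitePi fun _ : ℕ => D) := by
  have h : (Measure.infinitePi fun _ : ℕ => D).map (fun z i => z (e i)) =
      Measure.infinitePi fun _ : ℕ => D :=
    Measure.map_infinitePi_infinitePi_of_inj (P := fun _ : ℕ => D) e.injective
  conv_rhs => rw [← h]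
  rw [lintegral_map hΦ (by fun_prop)]

end Product

/-- The average of `Φ` over two transformed points with weights `p`. -/
noncomputable def boolAvg {Ω : Type*} (p : Bool → Ω → ℝ≥0∞) (T : Bool → Ω → Ω) (Φ : Ω → ℝ≥0∞)
    (z : Ω) : ℝ≥0∞ :=
  p true z * Φ (T true z) + p false z * Φ (T false z)

/-- Abstract union bound over a data-dependent net. The net is chosen at `z` but stays valid at
every `z'` reachable from `z` by the operations `T`, so averaging never changes it. It is used with
label redraws, which fix the points, and with swaps of sample and ghost points, which fix the set of
points. -/
theorem lintegral_le_of_cover {Ω ι : Type*} [MeasurableSpace Ω] (P : Measure Ω)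
    [IsProbabilityMeasure P] (p : ℕ → Bool → Ω → ℝ≥0∞) (T : ℕ → Bool → Ω → Ω)
    (r : Ω → Ω → Prop) (C : ℝ≥0∞) (N : ℕ) (hr : ∀ z, r z z) (n : ℕ)
    (hp : ∀ t < n, ∀ b, Measurable (p t b)) (hT : ∀ t < n, ∀ b, Measurable (T t b))
    (hinv : ∀ t < n, ∀ Φ : Ω → ℝ≥0∞, Measurable Φ →
      ∫⁻ z, Φ z ∂P ≤ ∫⁻ z, boolAvg (p t) (T t) Φ z ∂P)
    (hrT : ∀ t < n, ∀ b z z', r z z' → r z (T t b z'))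
    (Φ : Ω → ℝ≥0∞) (hΦ : Measurable Φ)
    (hcov : ∀ z, ∃ (J : Finset ι) (e : ι → ℕ → Ω → ℝ≥0∞), J.card ≤ N ∧
      (∀ z', r z z' → Φ z' ≤ C * ∑ j ∈ J, ∏ t ∈ Finset.range n, e j t z') ∧
      (∀ j ∈ J, ∀ t < n, ∀ z', r z z' → boolAvg (p t) (T t) (e j t) z' ≤ 1) ∧
      (∀ j ∈ J, ∀ t < n, ∀ s < t, ∀ b z', r z z' → e j s (T t b z') = e j s z')) :
    ∫⁻ z, Φ z ∂P ≤ C * N := by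
  induction n generalizing Φ with
  | zero =>
    have : ∀ z, Φ z ≤ C * N := by
      intro z
      obtain ⟨J, e, hJ, h1, -, -⟩ := hcov z
      refine (h1 z (hr z)).trans ?_
      simp only [Finset.range_zero, Finset.prod_empty, Finset.sum_const, nsmul_eq_mul, mul_one]
      gcongr
    calc ∫⁻ z, Φ z ∂P ≤ ∫⁻ _, C * N ∂P := lintegral_mono this
      _ = C * N := by simp
  | succ n ih =>
    -- The last operation is averaged first: it leaves the earlier factors alone and the average of
    -- its own factor is at most 1, so the induction hypothesis applies to the averaged function.
    refine (hinv n (Nat.lt_succ_self n) Φ hΦ).trans ?_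
    refine ih (fun t ht => hp t (ht.trans (Nat.lt_succ_self n)))
      (fun t ht => hT t (ht.trans (Nat.lt_succ_self n)))
      (fun t ht => hinv t (ht.trans (Nat.lt_succ_self n)))
      (fun t ht => hrT t (ht.trans (Nat.lt_succ_self n))) _ ?_ ?_
    · have h1 := fun b => hp n (Nat.lt_succ_self n) b
      have h2 := fun b => hΦ.comp (hT n (Nat.lt_succ_self n) b)
      exact ((h1 true).mul (h2 true)).add ((h1 false).mul (h2 false))
    · intro z
      obtain ⟨J, e, hJ, h1, h2, h3⟩ := hcov z
      refine ⟨J, e, hJ, ?_, fun j hj t ht => h2 j hj t (ht.trans (Nat.lt_succ_self n)),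
        fun j hj t ht => h3 j hj t (ht.trans (Nat.lt_succ_self n))⟩
      intro z' hz'
      have hn := Nat.lt_succ_self n
      have hprod : ∀ j ∈ J, ∀ b, ∏ t ∈ Finset.range (n + 1), e j t (T n b z') =
          (∏ t ∈ Finset.range n, e j t z') * e j n (T n b z') := by
        intro j hj b
        rw [Finset.prod_range_succ]
        congr 1
        exact Finset.prod_congr rfl fun s hs => h3 j hj n hn s (Finset.mem_range.1 hs) b z' hz'
      calc boolAvg (p n) (T n) Φ z'
          ≤ p n true z' * (C * ∑ j ∈ J, ∏ t ∈ Finset.range (n + 1), e j t (T n true z')) +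
            p n false z' * (C * ∑ j ∈ J, ∏ t ∈ Finset.range (n + 1), e j t (T n false z')) := by
            unfold boolAvg
            gcongr
            · exact h1 _ (hrT n hn true z z' hz')
            · exact h1 _ (hrT n hn false z z' hz')
        _ = C * ∑ j ∈ J, (∏ t ∈ Finset.range n, e j t z') * boolAvg (p n) (T n) (e j n) z' := by
            rw [Finset.sum_congr rfl fun j hj => hprod j hj true,
              Finset.sum_congr rfl fun j hj => hprod j hj false]
            simp only [Finset.mul_sum, ← Finset.sum_add_distrib, boolAvg]
            refine Finset.sum_congr rfl fun j _ => ?_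
            ring
        _ ≤ C * ∑ j ∈ J, ∏ t ∈ Finset.range n, e j t z' := by
            gcongr with j hj
            exact (mul_le_mul_right (h2 j hj n hn z' hz') _).trans (mul_one _).le

/-! ### Integration over the label -/

section Label

variable {X : Type*} [MeasurableSpace X] {D : Measure (X × Bool)} {η : X → ℝ}

/-- The conditional probability of the label `b`, when `q` is that of the label `true`. -/
noncomputable def labelProb (q : ℝ) (b : Bool) : ℝ := if b then q else 1 - q

theorem IsCondProb.measurable_labelProb (hη : IsCondProb D η) (b : Bool) :
    Measurable fun x => labelProb (η x) b := by
  have := hη.1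
  cases b <;> simp only [labelProb] <;> simp <;> fun_prop

theorem IsCondProb.labelProb_mem (hη : IsCondProb D η) (b : Bool) (x : X) :
    labelProb (η x) b ∈ Set.Icc (0 : ℝ) 1 := by
  have h := hη.2.1 x
  cases b <;> simp [labelProb, h.1, h.2]

variable [IsProbabilityMeasure D]

theorem IsCondProb.measure_prod (hη : IsCondProb D η) (b : Bool) {A : Set X}
    (hA : MeasurableSet A) :
    D (A ×ˢ {b}) = ∫⁻ x in A, ENNReal.ofReal (labelProb (η x) b) ∂D.fst := by
  cases b
  · have h1 : D.fst A = D (A ×ˢ {true}) + D (A ×ˢ {false}) := by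
      rw [Measure.fst_apply hA, ← measure_union]
      · congr 1
        ext ⟨x, y⟩
        cases y <;> simp
      · rw [Set.disjoint_left]
        rintro ⟨x, y⟩ h1 h2
        simp at h1 h2
        simp [h1.2] at h2
      · exact hA.prod (MeasurableSet.singleton _)
    have h2 : D.fst A = ∫⁻ x in A, ENNReal.ofReal (η x) ∂D.fst +
        ∫⁻ x in A, ENNReal.ofReal (labelProb (η x) false) ∂D.fst := by
      rw [← lintegral_add_left hη.1.ennreal_ofReal]
      have : ∀ x, ENNReal.ofReal (η x) + ENNReal.ofReal (labelProb (η x) false) = 1 := by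
        intro x
        rw [← ENNReal.ofReal_add (hη.2.1 x).1 (hη.labelProb_mem false x).1]
        simp [labelProb]
      simp [this]
    rw [hη.2.2 A hA] at h1
    rw [h1] at h2
    refine (ENNReal.add_right_inj ?_).1 h2
    rw [← hη.2.2 A hA]
    exact measure_ne_top _ _
  · simpa [labelProb] using hη.2.2 A hA

theorem IsCondProb.lintegral_eq (hη : IsCondProb D η) {Φ : X × Bool → ℝ≥0∞} (hΦ : Measurable Φ) :
    ∫⁻ w, Φ w ∂D = ∫⁻ x, (ENNReal.ofReal (labelProb (η x) true) * Φ (x, true) +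
      ENNReal.ofReal (labelProb (η x) false) * Φ (x, false)) ∂D.fst := by
  have hmk : ∀ b : Bool, Measurable fun x : X => (x, b) := fun b => by fun_prop
  have hΦb : ∀ b : Bool, Measurable fun x : X => Φ (x, b) := fun b => hΦ.comp (hmk b)
  have hD : D = (D.fst.withDensity fun x => ENNReal.ofReal (labelProb (η x) true)).map
      (fun x => (x, true)) +
      (D.fst.withDensity fun x => ENNReal.ofReal (labelProb (η x) false)).map
      (fun x => (x, false)) := by
    ext S hS
    have hpre : ∀ b : Bool, MeasurableSet ((fun x : X => (x, b)) ⁻¹' S) := fun b => hmk b hS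
    rw [Measure.add_apply, Measure.map_apply (hmk _) hS, Measure.map_apply (hmk _) hS,
      withDensity_apply _ (hpre _), withDensity_apply _ (hpre _), ← hη.measure_prod _ (hpre _),
      ← hη.measure_prod _ (hpre _), ← measure_union]
    · congr 1
      ext ⟨x, y⟩
      cases y <;> simp
    · rw [Set.disjoint_left]
      rintro ⟨x, y⟩ h1 h2
      simp at h1 h2
      simp [h1.2] at h2
    · exact (hpre _).prod (MeasurableSet.singleton _)
  conv_lhs => rw [hD]
  rw [lintegral_add_measure, lintegral_map hΦ (hmk _), lintegral_map hΦ (hmk _),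
    lintegral_withDensity_eq_lintegral_mul _ (hη.measurable_labelProb _).ennreal_ofReal
      (hΦb _),
    lintegral_withDensity_eq_lintegral_mul _ (hη.measurable_labelProb _).ennreal_ofReal
      (hΦb _), ← lintegral_add_left]
  · rfl
  · exact (hη.measurable_labelProb _).ennreal_ofReal.mul (hΦb _)

/-- Redrawing one label from its conditional law preserves the law of the data. After the whole
example is resampled on both sides, the left side sees only its point, and the claim is the
disintegration of `D`. -/
theorem IsCondProb.lintegral_labelAvg (hη : IsCondProb D η) (t : ℕ)
    {Φ : (ℕ → X × Bool) → ℝ≥0∞} (hΦ : Measurable Φ) :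
    ∫⁻ z, boolAvg (fun b z => ENNReal.ofReal (labelProb (η (z t).1) b))
        (fun b z => Function.update z t ((z t).1, b)) Φ z ∂(Measure.infinitePi fun _ : ℕ => D) =
      ∫⁻ z, Φ z ∂(Measure.infinitePi fun _ : ℕ => D) := by
  have hmT : ∀ b : Bool, Measurable fun z : ℕ → X × Bool =>
      Function.update z t ((z t).1, b) := fun b =>
    (measurable_update_const t).comp (f := fun z : ℕ → X × Bool => (z, ((z t).1, b)))
      (by fun_prop)
  have hmp : ∀ b : Bool, Measurable fun z : ℕ → X × Bool =>
      ENNReal.ofReal (labelProb (η (z t).1) b) := fun b =>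
    ((hη.measurable_labelProb b).comp (by fun_prop :
      Measurable fun z : ℕ → X × Bool => (z t).1)).ennreal_ofReal
  rw [← lintegral_resample D t hΦ, ← lintegral_resample D t]
  · refine lintegral_congr fun z => ?_
    have hup : Measurable fun w : X × Bool => Function.update z t w :=
      (measurable_update_const t).comp (f := fun w => (z, w)) (by fun_prop)
    have hΦup : Measurable fun w : X × Bool => Φ (Function.update z t w) := hΦ.comp hup
    rw [hη.lintegral_eq hΦup, Measure.fst, lintegral_map _ measurable_fst]
    · simp [boolAvg]
    · have hmk : ∀ b : Bool, Measurable fun x : X => (x, b) := fun b => by fun_prop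
      exact ((hη.measurable_labelProb _).ennreal_ofReal.mul (hΦup.comp (hmk _))).add
        ((hη.measurable_labelProb _).ennreal_ofReal.mul (hΦup.comp (hmk _)))
  · exact ((hmp true).mul (hΦ.comp (hmT true))).add ((hmp false).mul (hΦ.comp (hmT false)))

end Label

/-! ### Uniform control of the label noise under adaptive queries. -/

/-- Since `exp u ≤ 1 + u + u²` for `|u| ≤ 1` and the linear terms cancel, the uncompensated moment
is at most `1 + s² p (1 - p) ≤ 1 + s² / 4 ≤ exp v`. -/
theorem bernoulli_exp_le {p s v : ℝ} (hp : p ∈ Set.Icc (0 : ℝ) 1) (hs : |s| ≤ 1)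
    (hv : s ^ 2 / 4 ≤ v) :
    p * Real.exp (s * (1 - p) - v) + (1 - p) * Real.exp (s * (0 - p) - v) ≤ 1 := by
  obtain ⟨hp0, hp1⟩ := hp
  have h1 : |s * (1 - p)| ≤ 1 := by
    rw [abs_mul, abs_of_nonneg (by linarith : 0 ≤ 1 - p)]
    exact mul_le_one₀ hs (by linarith) (by linarith)
  have h2 : |s * (0 - p)| ≤ 1 := by
    rw [abs_mul, zero_sub, abs_neg, abs_of_nonneg hp0]
    exact mul_le_one₀ hs hp0 hp1
  have e1 := (abs_le.1 (Real.abs_exp_sub_one_sub_id_le h1)).2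
  have e2 := (abs_le.1 (Real.abs_exp_sub_one_sub_id_le h2)).2
  have e3 : s ^ 2 / 4 + 1 ≤ Real.exp v := (Real.add_one_le_exp _).trans (Real.exp_le_exp.2 hv)
  rw [Real.exp_sub, Real.exp_sub, mul_div_assoc', mul_div_assoc', ← add_div,
    div_le_one (Real.exp_pos _)]
  have e4 : p * Real.exp (s * (1 - p)) ≤ p * (1 + s * (1 - p) + (s * (1 - p)) ^ 2) :=
    mul_le_mul_of_nonneg_left (by linarith) hp0
  have e5 : (1 - p) * Real.exp (s * (0 - p)) ≤ (1 - p) * (1 + s * (0 - p) + (s * (0 - p)) ^ 2) :=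
    mul_le_mul_of_nonneg_left (by linarith) (by linarith)
  have e6 : 0 ≤ s ^ 2 * (2 * p - 1) ^ 2 := by positivity
  nlinarith

section Noise

variable {X : Type*}

/-- The weighted noise of the increment of the squared loss of `f` relative to `g`, compensated by
half of the squared difference. -/
noncomputable def noiseTerm (η g f : X → ℝ) (q : ℝ) (p : X × Bool) : ℝ :=
  q * (2 * (f p.1 - g p.1) * (labelValue p.2 - η p.1) - (f p.1 - g p.1) ^ 2 / 2)

theorem labelValue_mem (b : Bool) : labelValue b ∈ Set.Icc (0 : ℝ) 1 := by
  cases b <;> simp [labelValue]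

theorem noiseTerm_sub_le {η g f f' : X → ℝ} {q α : ℝ} {p : X × Bool}
    (hη : η p.1 ∈ Set.Icc (0 : ℝ) 1) (hg : g p.1 ∈ Set.Icc (0 : ℝ) 1)
    (hf : f p.1 ∈ Set.Icc (0 : ℝ) 1) (hf' : f' p.1 ∈ Set.Icc (0 : ℝ) 1)
    (hq : q ∈ Set.Icc (0 : ℝ) 1) (hα : |f p.1 - f' p.1| ≤ α) :
    noiseTerm η g f q p ≤ noiseTerm η g f' q p + 3 * α := by
  have hl := labelValue_mem p.2
  unfold noiseTerm
  generalize η p.1 = e at *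
  generalize g p.1 = a at *
  generalize f p.1 = b at *
  generalize f' p.1 = c at *
  generalize labelValue p.2 = y at *
  have h0 : 0 ≤ α := (abs_nonneg _).trans hα
  -- This is the difference quotient of the unweighted noise term in the value of `f`: at most 2
  -- from the noise and 1 from the compensator.
  have h1 : |2 * (y - e) - (b + c - 2 * a) / 2| ≤ 3 := by
    rw [abs_le]; constructor <;> linarith [hl.1, hl.2, hη.1, hη.2, hg.1, hg.2, hf.1, hf.2, hf'.1, hf'.2]
  have h2 : q * |(b - c) * (2 * (y - e) - (b + c - 2 * a) / 2)| ≤ α * 3 := by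
    rw [abs_mul]
    have : |b - c| * |2 * (y - e) - (b + c - 2 * a) / 2| ≤ α * 3 :=
      mul_le_mul hα h1 (abs_nonneg _) h0
    exact (mul_le_of_le_one_left (by positivity) hq.2).trans this
  have h3 : q * ((b - c) * (2 * (y - e) - (b + c - 2 * a) / 2)) ≤ α * 3 :=
    (mul_le_mul_of_nonneg_left (le_abs_self _) hq.1).trans h2
  nlinarith

/-- Half the noise term is `s (y - η) - v` with `s = q (f - g)` and `v = q (f - g)² / 4`; the
inequality `q² ≤ q` gives `s² / 4 ≤ v`. -/
theorem noiseTerm_avg_le {η g f : X → ℝ} {q : ℝ} {x : X}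
    (hη : η x ∈ Set.Icc (0 : ℝ) 1) (hg : g x ∈ Set.Icc (0 : ℝ) 1)
    (hf : f x ∈ Set.Icc (0 : ℝ) 1) (hq : q ∈ Set.Icc (0 : ℝ) 1) :
    ENNReal.ofReal (labelProb (η x) true) *
        ENNReal.ofReal (Real.exp (noiseTerm η g f q (x, true) / 2)) +
      ENNReal.ofReal (labelProb (η x) false) *
        ENNReal.ofReal (Real.exp (noiseTerm η g f q (x, false) / 2)) ≤ 1 := by
  have h1 : 0 ≤ labelProb (η x) true := by simpa [labelProb] using hη.1
  have h2 : 0 ≤ labelProb (η x) false := by simpa [labelProb] using hη.2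
  rw [← ENNReal.ofReal_mul h1, ← ENNReal.ofReal_mul h2, ← ENNReal.ofReal_add (by positivity)
    (by positivity), ENNReal.ofReal_le_one]
  have hu : |f x - g x| ≤ 1 := by
    rw [abs_le]; constructor <;> linarith [hf.1, hf.2, hg.1, hg.2]
  have hs : |q * (f x - g x)| ≤ 1 := by
    rw [abs_mul, abs_of_nonneg hq.1]
    exact mul_le_one₀ hq.2 (abs_nonneg _) hu
  have hv : (q * (f x - g x)) ^ 2 / 4 ≤ q * (f x - g x) ^ 2 / 4 := by
    have : q * q ≤ q * 1 := mul_le_mul_of_nonneg_left hq.2 hq.1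
    have := mul_le_mul_of_nonneg_right this (sq_nonneg (f x - g x))
    nlinarith
  have := bernoulli_exp_le hη hs hv
  convert this using 4 <;> simp [labelProb, noiseTerm, labelValue] <;> ring_nf

variable [MeasurableSpace X] {D : Measure (X × Bool)} [IsProbabilityMeasure D] {η : X → ℝ}

theorem measurable_labelValue : Measurable labelValue := measurable_from_top

/-- The weights `q` may depend on all points and on earlier labels, as the query decisions do. The
net depends on the points only, so redrawing labels keeps it. -/
theorem measure_noise_gt_le (hη : IsCondProb D η) {F : Set (X → ℝ)}
    (hF : ∀ f ∈ F, Measurable f ∧ ∀ x, f x ∈ Set.Icc (0 : ℝ) 1) (hsep : PointwiseSeparable F)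
    {d : ℕ} (hd : pdim F = d) {g : X → ℝ} (hg : g ∈ F) {n : ℕ} (hn : 0 < n)
    {q : ℕ → (ℕ → X × Bool) → ℝ} (hqm : ∀ t < n, Measurable (q t))
    (hq : ∀ t z, q t z ∈ Set.Icc (0 : ℝ) 1)
    (hqi : ∀ t < n, ∀ s ≤ t, ∀ z b, q s (Function.update z t ((z t).1, b)) = q s z) (B : ℝ) :
    Measure.infinitePi (fun _ : ℕ => D)
      {z | ∃ f ∈ F, B < ∑ t ∈ Finset.range n, noiseTerm η g f (q t z) (z t)} ≤
      ENNReal.ofReal (Real.exp ((3 - B) / 2)) * ((n * n + 1) ^ d : ℕ) := by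
  classical
  obtain ⟨G, hGF, hGc, hG⟩ := hsep
  set E : Set (ℕ → X × Bool) :=
    ⋃ f ∈ G, {z | B < ∑ t ∈ Finset.range n, noiseTerm η g f (q t z) (z t)} with hE
  have hEm : MeasurableSet E := by
    refine MeasurableSet.biUnion hGc fun f hf => measurableSet_lt measurable_const ?_
    refine Finset.measurable_sum _ fun t ht => ?_
    have m1 := hqm t (Finset.mem_range.1 ht)
    have m2 := (hF f (hGF hf)).1
    have m3 := (hF g hg).1
    have m4 := hη.1
    have m5 := measurable_labelValue
    unfold noiseTerm
    fun_prop
  -- A strict inequality survives pointwise approximation, so the countable subclass gives a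
  -- measurable event containing the one of interest.
  have hsub : {z | ∃ f ∈ F, B < ∑ t ∈ Finset.range n, noiseTerm η g f (q t z) (z t)} ⊆ E := by
    rintro z ⟨f, hf, hz⟩
    obtain ⟨u, huG, hu⟩ := hG f hf
    have hlim : Tendsto (fun k => ∑ t ∈ Finset.range n, noiseTerm η g (u k) (q t z) (z t)) atTop
        (𝓝 (∑ t ∈ Finset.range n, noiseTerm η g f (q t z) (z t))) := by
      refine tendsto_finsetSum _ fun t _ => ?_
      have := hu (z t).1
      exact ((((this.sub_const _).const_mul 2).mul_const _).sub
        (((this.sub_const _).pow 2).div_const 2)).const_mul _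
    obtain ⟨k, hk⟩ := (hlim.eventually_const_lt hz).exists
    exact Set.mem_biUnion (huG k) hk
  refine (measure_mono hsub).trans ?_
  rw [← lintegral_indicator_one hEm]
  have hmT : ∀ (t : ℕ) (b : Bool), Measurable fun z : ℕ → X × Bool =>
      Function.update z t ((z t).1, b) := fun t b =>
    (measurable_update_const t).comp (f := fun z : ℕ → X × Bool => (z, ((z t).1, b)))
      (by fun_prop)
  have hmp : ∀ (t : ℕ) (b : Bool), Measurable fun z : ℕ → X × Bool =>
      ENNReal.ofReal (labelProb (η (z t).1) b) := fun t b =>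
    ((hη.measurable_labelProb b).comp (by fun_prop :
      Measurable fun z : ℕ → X × Bool => (z t).1)).ennreal_ofReal
  refine lintegral_le_of_cover (ι := X → ℝ) (Measure.infinitePi fun _ : ℕ => D)
    (fun t b z => ENNReal.ofReal (labelProb (η (z t).1) b))
    (fun t b z => Function.update z t ((z t).1, b))
    (fun z z' => ∀ t, (z' t).1 = (z t).1) _ _ (fun _ _ => rfl) n (fun t _ => hmp t)
    (fun t _ => hmT t) (fun t _ Φ hΦ => (hη.lintegral_labelAvg t hΦ).ge) ?_ _
    (measurable_one.indicator hEm) ?_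
  · intro t _ b z z' h s
    rw [← h s]
    by_cases hst : s = t
    · subst hst; simp
    · simp [hst]
  · intro z
    -- With scale `1 / n`, passing to the net costs `3 / n` per point, hence 3 in total.
    obtain ⟨J, hJF, hJc, hJ⟩ := exists_uniform_cover (fun f hf => (hF f hf).2) hd
      ((Finset.range n).image fun t => (z t).1) hn
    refine ⟨J, fun f t z' => ENNReal.ofReal (Real.exp (noiseTerm η g f (q t z') (z' t) / 2)),
      ?_, ?_, ?_, ?_⟩
    · refine hJc.trans ?_
      gcongr
      simpa using Finset.card_image_le (s := Finset.range n) (f := fun t => (z t).1)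
    · intro z' hz'
      by_cases hzE : z' ∈ E
      · obtain ⟨f, hfG, hf⟩ := Set.mem_iUnion₂.1 hzE
        rw [Set.indicator_of_mem hzE]
        obtain ⟨f', hf'J, hff'⟩ := hJ f (hGF hfG)
        have hle : ∑ t ∈ Finset.range n, noiseTerm η g f (q t z') (z' t) ≤
            ∑ t ∈ Finset.range n, noiseTerm η g f' (q t z') (z' t) + 3 := by
          have : ∀ t ∈ Finset.range n, noiseTerm η g f (q t z') (z' t) ≤
              noiseTerm η g f' (q t z') (z' t) + 3 * (1 / n) := fun t ht =>
            noiseTerm_sub_le (hη.2.1 _) ((hF g hg).2 _) ((hF f (hGF hfG)).2 _)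
              ((hF f' (hJF f' hf'J)).2 _) (hq t z')
              (by rw [hz' t]; exact hff' _ (Finset.mem_image_of_mem _ ht))
          refine (Finset.sum_le_sum this).trans ?_
          rw [Finset.sum_add_distrib, Finset.sum_const, Finset.card_range, nsmul_eq_mul]
          have hn' : (n : ℝ) ≠ 0 := by positivity
          field_simp
          exact le_rfl
        calc (1 : ℝ≥0∞) ≤ ENNReal.ofReal (Real.exp ((3 - B) / 2)) *
              ∏ t ∈ Finset.range n, ENNReal.ofReal (Real.exp (noiseTerm η g f' (q t z') (z' t) / 2)) := by
              rw [← ENNReal.ofReal_prod_of_nonneg fun _ _ => (Real.exp_pos _).le, ← Real.exp_sum,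
                ← ENNReal.ofReal_mul (Real.exp_pos _).le, ← Real.exp_add, ENNReal.one_le_ofReal,
                Real.one_le_exp_iff, ← Finset.sum_div]
              have hf2 : B < ∑ t ∈ Finset.range n, noiseTerm η g f (q t z') (z' t) := hf
              linarith
          _ ≤ _ := by
              gcongr
              exact Finset.single_le_sum (f := fun f => ∏ t ∈ Finset.range n,
                ENNReal.ofReal (Real.exp (noiseTerm η g f (q t z') (z' t) / 2)))
                (fun _ _ => zero_le) hf'J
      · rw [Set.indicator_of_notMem hzE]
        exact zero_le
    · intro f hf t ht z' _
      have := noiseTerm_avg_le (f := f) (hη.2.1 (z' t).1) ((hF g hg).2 _)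
        ((hF f (hJF f hf)).2 _) (hq t z')
      simpa [boolAvg, hqi t ht t le_rfl] using this
    · intro f _ t ht s hst b z' _
      simp [hqi t ht s hst.le, hst.ne]

end Noise

/-! ### Empirical versus mean squared distance, by a ghost sample. -/

theorem ofReal_exp_integral_le {X : Type*} [MeasurableSpace X] (μ : Measure X)
    [IsProbabilityMeasure μ] {h : X → ℝ} (hm : Measurable h) (hh : ∀ x, h x ∈ Set.Icc (0 : ℝ) 1)
    (c l : ℝ) (hl : 0 ≤ l) :
    ENNReal.ofReal (Real.exp (c + l * ∫ x, h x ∂μ)) ≤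
      ∫⁻ x, ENNReal.ofReal (Real.exp (c + l * h x)) ∂μ := by
  have hi : Integrable h μ := Integrable.of_bound hm.aestronglyMeasurable 1
    (Eventually.of_forall fun x => by
      rw [Real.norm_eq_abs, abs_of_nonneg (hh x).1]; exact (hh x).2)
  have hie : Integrable (fun x => Real.exp (c + l * h x)) μ :=
    Integrable.of_bound (by fun_prop) (Real.exp (c + l * 1)) (Eventually.of_forall fun x => by
      rw [Real.norm_eq_abs, Real.abs_exp]
      exact Real.exp_le_exp.2
        (add_le_add_right (mul_le_mul_of_nonneg_left (hh x).2 hl) c))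
  rw [← ofReal_integral_eq_lintegral_ofReal hie
    (Eventually.of_forall fun x => (Real.exp_pos _).le)]
  refine ENNReal.ofReal_le_ofReal ?_
  have h2 : Integrable (fun x => c + l * h x) μ := (integrable_const c).add (hi.const_mul l)
  have h1 := convexOn_exp.map_integral_le (μ := μ) (f := fun x => c + l * h x)
    Real.continuous_exp.continuousOn isClosed_univ (Eventually.of_forall fun _ => trivial) h2 hie
  rw [integral_add (integrable_const c) (hi.const_mul l), integral_const_mul] at h1
  simpa using h1

/-- The factor 2 leaves a negative linear part `-(u + v) / 8` in the sum of exponents, and this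
dominates the quadratic terms because `u² ≤ u` and `v² ≤ v`. -/
theorem exp_swap_le {u v : ℝ} (hu : u ∈ Set.Icc (0 : ℝ) 1) (hv : v ∈ Set.Icc (0 : ℝ) 1) :
    Real.exp ((v - 2 * u) / 8) + Real.exp ((u - 2 * v) / 8) ≤ 2 := by
  obtain ⟨hu0, hu1⟩ := hu
  obtain ⟨hv0, hv1⟩ := hv
  have h1 : |(v - 2 * u) / 8| ≤ 1 := by rw [abs_le]; constructor <;> linarith
  have h2 : |(u - 2 * v) / 8| ≤ 1 := by rw [abs_le]; constructor <;> linarith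
  have e1 := (abs_le.1 (Real.abs_exp_sub_one_sub_id_le h1)).2
  have e2 := (abs_le.1 (Real.abs_exp_sub_one_sub_id_le h2)).2
  nlinarith [mul_nonneg hu0 hv0, mul_nonneg hu0 (sub_nonneg.2 hu1),
    mul_nonneg hv0 (sub_nonneg.2 hv1)]

section Ghost

variable {X : Type*}

/-- The squared difference of `f` and `g` at the point `x`, with weight `w`. -/
noncomputable def wsq (w g f : X → ℝ) (x : X) : ℝ := w x * (f x - g x) ^ 2

theorem wsq_mem {w g f : X → ℝ} {x : X} (hw : w x ∈ Set.Icc (0 : ℝ) 1)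
    (hg : g x ∈ Set.Icc (0 : ℝ) 1) (hf : f x ∈ Set.Icc (0 : ℝ) 1) :
    wsq w g f x ∈ Set.Icc (0 : ℝ) 1 := by
  have hu : |f x - g x| ≤ 1 := by
    rw [abs_le]; constructor <;> linarith [hf.1, hf.2, hg.1, hg.2]
  exact ⟨mul_nonneg hw.1 (sq_nonneg _), mul_le_one₀ hw.2 (sq_nonneg _)
    ((sq_le_one_iff_abs_le_one _).2 hu)⟩

theorem wsq_abs_sub_le {w g f f' : X → ℝ} {x : X} {α : ℝ} (hw : w x ∈ Set.Icc (0 : ℝ) 1)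
    (hg : g x ∈ Set.Icc (0 : ℝ) 1) (hf : f x ∈ Set.Icc (0 : ℝ) 1)
    (hf' : f' x ∈ Set.Icc (0 : ℝ) 1) (hα : |f x - f' x| ≤ α) :
    |wsq w g f x - wsq w g f' x| ≤ 2 * α := by
  have h1 : |f x + f' x - 2 * g x| ≤ 2 := by
    rw [abs_le]; constructor <;> linarith [hf.1, hf.2, hg.1, hg.2, hf'.1, hf'.2]
  have h2 : wsq w g f x - wsq w g f' x = w x * ((f x + f' x - 2 * g x) * (f x - f' x)) := by
    unfold wsq; ring
  rw [h2, abs_mul, abs_of_nonneg hw.1, abs_mul]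
  exact (mul_le_of_le_one_left (by positivity) hw.2).trans
    (mul_le_mul h1 hα (abs_nonneg _) (by norm_num))

variable [MeasurableSpace X] (D : Measure (X × Bool)) [IsProbabilityMeasure D]

/-- The exponential of the deviation between the empirical and the mean weighted squared difference,
where the first `j` of the `k` copies of the mean have been replaced by ghost observations. -/
noncomputable def ghostExp (w : (ℕ → X × Bool) → X → ℝ) (g : X → ℝ) (a k j : ℕ) (f : X → ℝ)
    (z : ℕ → X × Bool) : ℝ≥0∞ :=
  ENNReal.ofReal (Real.exp
    ((∑ i ∈ Finset.range j, wsq (w z) g f (z (a + k + i)).1 +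
      ((k : ℝ) - j) * ∫ x, wsq (w z) g f x ∂D.fst -
      2 * ∑ i ∈ Finset.range k, wsq (w z) g f (z (a + i)).1) / 8))

variable {D} {w : (ℕ → X × Bool) → X → ℝ} {g : X → ℝ} {a k : ℕ}

theorem measurable_wsq_eval (hwm : Measurable fun p : (ℕ → X × Bool) × X => w p.1 p.2)
    (hg : Measurable g) {f : X → ℝ} (hf : Measurable f) (t : ℕ) :
    Measurable fun z : ℕ → X × Bool => wsq (w z) g f (z t).1 := by
  have h1 : Measurable fun z : ℕ → X × Bool => w z (z t).1 :=
    hwm.comp (f := fun z : ℕ → X × Bool => (z, (z t).1)) (by fun_prop)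
  unfold wsq
  fun_prop

theorem measurable_wsq_integral (hwm : Measurable fun p : (ℕ → X × Bool) × X => w p.1 p.2)
    (hg : Measurable g) {f : X → ℝ} (hf : Measurable f) :
    Measurable fun z : ℕ → X × Bool => ∫ x, wsq (w z) g f x ∂D.fst := by
  have h1 : Measurable fun p : (ℕ → X × Bool) × X => wsq (w p.1) g f p.2 := by
    unfold wsq
    fun_prop
  exact h1.stronglyMeasurable.integral_prod_right'.measurable

theorem measurable_ghostExp (hwm : Measurable fun p : (ℕ → X × Bool) × X => w p.1 p.2)
    (hg : Measurable g) {f : X → ℝ} (hf : Measurable f) (j : ℕ) :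
    Measurable (ghostExp D w g a k j f) := by
  have h1 := fun t => measurable_wsq_eval hwm hg hf t
  have h2 := measurable_wsq_integral (D := D) hwm hg hf
  unfold ghostExp
  fun_prop

/-- Jensen's inequality in a single coordinate. That coordinate lies beyond both the past that
determines `w` and the sample window, so only the new ghost term depends on it. -/
theorem ghostExp_le_lintegral_succ (hwm : Measurable fun p : (ℕ → X × Bool) × X => w p.1 p.2)
    (hw : ∀ z x, w z x ∈ Set.Icc (0 : ℝ) 1)
    (hwi : ∀ z z', (∀ t < a, z t = z' t) → w z = w z')
    (hg : Measurable g ∧ ∀ x, g x ∈ Set.Icc (0 : ℝ) 1) {f : X → ℝ}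
    (hf : Measurable f ∧ ∀ x, f x ∈ Set.Icc (0 : ℝ) 1) (j : ℕ) (z : ℕ → X × Bool) :
    ghostExp D w g a k j f z ≤
      ∫⁻ v, ghostExp D w g a k (j + 1) f (Function.update z (a + k + j) v) ∂D := by
  have hwu : ∀ v, w (Function.update z (a + k + j) v) = w z := fun v =>
    hwi _ _ fun t ht => by rw [Function.update_of_ne (by omega)]
  have h1 : ∀ v, ghostExp D w g a k (j + 1) f (Function.update z (a + k + j) v) =
      ENNReal.ofReal (Real.exp ((∑ i ∈ Finset.range j, wsq (w z) g f (z (a + k + i)).1 +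
      ((k : ℝ) - (j + 1)) * ∫ x, wsq (w z) g f x ∂D.fst -
      2 * ∑ i ∈ Finset.range k, wsq (w z) g f (z (a + i)).1) / 8 +
      1 / 8 * wsq (w z) g f v.1)) := by
    intro v
    unfold ghostExp
    rw [hwu v, Finset.sum_range_succ, Function.update_self]
    have s1 : ∑ i ∈ Finset.range j,
        wsq (w z) g f (Function.update z (a + k + j) v (a + k + i)).1 =
        ∑ i ∈ Finset.range j, wsq (w z) g f (z (a + k + i)).1 := by
      refine Finset.sum_congr rfl fun i hi => ?_
      have := Finset.mem_range.1 hi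
      rw [Function.update_of_ne (by omega)]
    have s2 : ∑ i ∈ Finset.range k, wsq (w z) g f (Function.update z (a + k + j) v (a + i)).1 =
        ∑ i ∈ Finset.range k, wsq (w z) g f (z (a + i)).1 := by
      refine Finset.sum_congr rfl fun i hi => ?_
      have := Finset.mem_range.1 hi
      rw [Function.update_of_ne (by omega)]
    rw [s1, s2]
    congr 2
    push_cast
    ring
  simp_rw [h1]
  have hwz : Measurable (w z) := hwm.comp (f := fun x => (z, x)) (by fun_prop)
  have hm : Measurable (wsq (w z) g f) := by
    have := hg.1
    have := hf.1
    unfold wsq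
    fun_prop
  have h2 := ofReal_exp_integral_le D.fst hm
    (fun x => wsq_mem (hw z x) (hg.2 x) (hf.2 x))
    ((∑ i ∈ Finset.range j, wsq (w z) g f (z (a + k + i)).1 +
      ((k : ℝ) - (j + 1)) * ∫ x, wsq (w z) g f x ∂D.fst -
      2 * ∑ i ∈ Finset.range k, wsq (w z) g f (z (a + i)).1) / 8) (1 / 8) (by norm_num)
  conv_rhs at h2 => rw [Measure.fst, lintegral_map (by fun_prop) measurable_fst]
  refine le_trans (le_of_eq ?_) h2
  unfold ghostExp
  congr 2
  ring

/-- The ghost sample is the next block of `k` coordinates of the same sequence. Means are replaced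
by ghost observations one by one, and then sample and ghost points are swapped in pairs with
probability `1/2`. Since `w` depends only on coordinates before `a`, it is constant throughout. -/
theorem measure_ghost_gt_le {F : Set (X → ℝ)}
    (hF : ∀ f ∈ F, Measurable f ∧ ∀ x, f x ∈ Set.Icc (0 : ℝ) 1) (hsep : PointwiseSeparable F)
    {d : ℕ} (hd : pdim F = d) (hg : g ∈ F) (hk : 0 < k)
    (hwm : Measurable fun p : (ℕ → X × Bool) × X => w p.1 p.2)
    (hw : ∀ z x, w z x ∈ Set.Icc (0 : ℝ) 1)
    (hwi : ∀ z z', (∀ t < a, z t = z' t) → w z = w z') (B : ℝ) :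
    Measure.infinitePi (fun _ : ℕ => D)
      {z | ∃ f ∈ F, B < k * ∫ x, wsq (w z) g f x ∂D.fst -
        2 * ∑ i ∈ Finset.range k, wsq (w z) g f (z (a + i)).1} ≤
      ENNReal.ofReal (Real.exp ((6 - B) / 8)) * ((2 * k * k + 1) ^ d : ℕ) := by
  classical
  obtain ⟨G, hGF, hGc, hG⟩ := hsep
  set P := Measure.infinitePi (fun _ : ℕ => D) with hP
  let Θ : ℕ → (ℕ → X × Bool) → ℝ≥0∞ := fun j z => ⨆ f ∈ G, ghostExp D w g a k j f z
  have hΘm : ∀ j, Measurable (Θ j) := fun j => by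
    refine Measurable.biSup G hGc fun f hf => ?_
    exact measurable_ghostExp hwm (hF g hg).1 (hF f (hGF hf)).1 j
  have hstep : ∀ j, ∫⁻ z, Θ j z ∂P ≤ ∫⁻ z, Θ (j + 1) z ∂P := by
    intro j
    rw [hP, ← lintegral_resample D (a + k + j) (hΘm (j + 1))]
    refine lintegral_mono fun z => iSup₂_le fun f hf => ?_
    refine (ghostExp_le_lintegral_succ hwm hw hwi (hF g hg) (hF f (hGF hf)) j z).trans ?_
    exact lintegral_mono fun v => le_iSup₂_of_le (f := fun f (_ : f ∈ G) =>
      ghostExp D w g a k (j + 1) f (Function.update z (a + k + j) v)) f hf le_rfl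
  have hchain : ∫⁻ z, Θ 0 z ∂P ≤ ∫⁻ z, Θ k z ∂P :=
    monotone_nat_of_le_succ (f := fun j => ∫⁻ z, Θ j z ∂P) hstep (Nat.zero_le k)
  have hswapm : ∀ (i : ℕ) (b : Bool), Measurable fun z : ℕ → X × Bool =>
      if b then z else fun s => z (Equiv.swap (a + i) (a + k + i) s) := by
    intro i b
    cases b <;> simp <;> fun_prop
  have hcover : ∫⁻ z, Θ k z ∂P ≤
      ENNReal.ofReal (Real.exp (6 / 8)) * ((2 * k * k + 1) ^ d : ℕ) := by
    refine lintegral_le_of_cover (ι := X → ℝ) P (fun _ _ _ => 2⁻¹)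
      (fun i b z => if b then z else fun s => z (Equiv.swap (a + i) (a + k + i) s))
      -- Reachable sequences share the past before `a` and take their points in the double window
      -- from those of `z`, which is all that the net needs.
      (fun z z' => (∀ t < a, z' t = z t) ∧ ∀ i < 2 * k, ∃ i' < 2 * k,
        (z' (a + i)).1 = (z (a + i')).1) _ _ (fun z => ⟨fun _ _ => rfl, fun i hi => ⟨i, hi, rfl⟩⟩)
      k (fun _ _ _ => measurable_const) (fun i _ b => hswapm i b) ?_ ?_ _ (hΘm k) ?_
    · intro i _ Φ hΦ
      have h1 := lintegral_perm D (Equiv.swap (a + i) (a + k + i)) hΦ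
      have hΦ' : Measurable fun z : ℕ → X × Bool =>
          Φ fun s => z (Equiv.swap (a + i) (a + k + i) s) := hΦ.comp (by fun_prop)
      simp only [boolAvg, if_true, Bool.false_eq_true, if_false]
      rw [lintegral_add_left (hΦ.const_mul _), lintegral_const_mul _ hΦ,
        lintegral_const_mul _ hΦ', h1, ← add_mul, ENNReal.inv_two_add_inv_two,
        one_mul]
    · rintro i hi b z z' ⟨h1, h2⟩
      cases b
      · simp only [Bool.false_eq_true, if_false]
        refine ⟨fun t ht => ?_, fun s hs => ?_⟩
        · rw [Equiv.swap_apply_of_ne_of_ne (by omega) (by omega)]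
          exact h1 t ht
        · by_cases e1 : s = i
          · subst e1
            rw [Equiv.swap_apply_left, add_assoc]
            exact h2 _ (by omega)
          · by_cases e2 : s = k + i
            · subst e2
              rw [← add_assoc, Equiv.swap_apply_right]
              exact h2 _ (by omega)
            · rw [Equiv.swap_apply_of_ne_of_ne (by omega) (by omega)]
              exact h2 s hs
      · exact ⟨h1, h2⟩
    · intro z
      obtain ⟨J, hJF, hJc, hJ⟩ := exists_uniform_cover (fun f hf => (hF f hf).2) hd
        ((Finset.range (2 * k)).image fun i => (z (a + i)).1) hk
      refine ⟨J, fun f i z' => ENNReal.ofReal (Real.exp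
        ((wsq (w z') g f (z' (a + k + i)).1 - 2 * wsq (w z') g f (z' (a + i)).1) / 8)),
        ?_, ?_, ?_, ?_⟩
      · refine hJc.trans ?_
        gcongr
        simpa using Finset.card_image_le (s := Finset.range (2 * k)) (f := fun i => (z (a + i)).1)
      · rintro z' ⟨-, hz'⟩
        refine iSup₂_le fun f hf => ?_
        obtain ⟨f', hf'J, hff'⟩ := hJ f (hGF hf)
        have hclose : ∀ i < 2 * k, |wsq (w z') g f (z' (a + i)).1 -
            wsq (w z') g f' (z' (a + i)).1| ≤ 2 * (1 / k) := fun i hi =>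
          wsq_abs_sub_le (hw _ _) ((hF g hg).2 _) ((hF f (hGF hf)).2 _) ((hF f' (hJF f' hf'J)).2 _)
            (by
              obtain ⟨i', hi', he⟩ := hz' i hi
              rw [he]
              exact hff' _ (Finset.mem_image.2 ⟨i', Finset.mem_range.2 hi', rfl⟩))
        -- Each weighted square moves by at most `2 / k`; the ghost term counts once and the sample
        -- term twice, which gives `6 / k`.
        have hterm : ∀ i ∈ Finset.range k,
            wsq (w z') g f (z' (a + k + i)).1 - 2 * wsq (w z') g f (z' (a + i)).1 ≤
            wsq (w z') g f' (z' (a + k + i)).1 - 2 * wsq (w z') g f' (z' (a + i)).1 +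
              6 * (1 / k) := by
          intro i hi
          have hi' := Finset.mem_range.1 hi
          have c1 := (abs_le.1 (hclose i (by omega))).1
          have c2 := (abs_le.1 (hclose (k + i) (by omega))).2
          rw [← add_assoc] at c2
          linarith
        have hle := Finset.sum_le_sum hterm
        rw [Finset.sum_add_distrib, Finset.sum_const, Finset.card_range, nsmul_eq_mul,
          show (k : ℝ) * (6 * (1 / k)) = 6 by
            have : (k : ℝ) ≠ 0 := by positivity
            field_simp, Finset.sum_sub_distrib, ← Finset.mul_sum] at hle
        calc ghostExp D w g a k k f z' ≤ ENNReal.ofReal (Real.exp (6 / 8)) *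
              ∏ i ∈ Finset.range k, ENNReal.ofReal (Real.exp
              ((wsq (w z') g f' (z' (a + k + i)).1 - 2 * wsq (w z') g f' (z' (a + i)).1) / 8)) := by
              rw [← ENNReal.ofReal_prod_of_nonneg fun _ _ => (Real.exp_pos _).le, ← Real.exp_sum,
                ← ENNReal.ofReal_mul (Real.exp_pos _).le, ← Real.exp_add, ← Finset.sum_div]
              refine ENNReal.ofReal_le_ofReal (Real.exp_le_exp.2 ?_)
              rw [sub_self, zero_mul, add_zero]
              linarith
          _ ≤ _ := by
              gcongr
              exact Finset.single_le_sum (f := fun f => ∏ i ∈ Finset.range k,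
                ENNReal.ofReal (Real.exp
                ((wsq (w z') g f (z' (a + k + i)).1 - 2 * wsq (w z') g f (z' (a + i)).1) / 8)))
                (fun _ _ => zero_le) hf'J
      · intro f hf i hi z' _
        have hwz : w (fun s => z' (Equiv.swap (a + i) (a + k + i) s)) = w z' :=
          hwi _ _ fun t ht => by rw [Equiv.swap_apply_of_ne_of_ne (by omega) (by omega)]
        simp only [boolAvg, if_true, Bool.false_eq_true, if_false, hwz, Equiv.swap_apply_left,
          Equiv.swap_apply_right]
        rw [← mul_add, ← ENNReal.ofReal_add (Real.exp_pos _).le (Real.exp_pos _).le]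
        have := exp_swap_le (wsq_mem (hw z' (z' (a + i)).1) ((hF g hg).2 _)
          ((hF f (hJF f hf)).2 _)) (wsq_mem (hw z' (z' (a + k + i)).1) ((hF g hg).2 _)
          ((hF f (hJF f hf)).2 _))
        calc _ ≤ (2⁻¹ : ℝ≥0∞) * ENNReal.ofReal 2 := by gcongr
          _ = 1 := by
            rw [ENNReal.ofReal_ofNat, ENNReal.inv_mul_cancel (by norm_num) (by norm_num)]
      · intro f hf i hi s hs b z' _
        cases b
        · have hwz : w (fun s => z' (Equiv.swap (a + i) (a + k + i) s)) = w z' :=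
            hwi _ _ fun t ht => by rw [Equiv.swap_apply_of_ne_of_ne (by omega) (by omega)]
          simp only [Bool.false_eq_true, if_false, hwz]
          rw [Equiv.swap_apply_of_ne_of_ne (by omega) (by omega),
            Equiv.swap_apply_of_ne_of_ne (by omega) (by omega)]
        · simp
  have hsub : {z | ∃ f ∈ F, B < k * ∫ x, wsq (w z) g f x ∂D.fst -
      2 * ∑ i ∈ Finset.range k, wsq (w z) g f (z (a + i)).1} ⊆
      {z | ENNReal.ofReal (Real.exp (B / 8)) ≤ Θ 0 z} := by
    rintro z ⟨f, hf, hz⟩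
    obtain ⟨u, huG, hu⟩ := hG f hf
    have hpt : ∀ x, Tendsto (fun n => wsq (w z) g (u n) x) atTop (𝓝 (wsq (w z) g f x)) :=
      fun x => (((hu x).sub_const _).pow 2).const_mul _
    have hint : Tendsto (fun n => ∫ x, wsq (w z) g (u n) x ∂D.fst) atTop
        (𝓝 (∫ x, wsq (w z) g f x ∂D.fst)) := by
      refine tendsto_integral_of_dominated_convergence (fun _ => 1) (fun n => ?_)
        (integrable_const _) (fun n => Eventually.of_forall fun x => ?_)
        (Eventually.of_forall hpt)
      · have hwz : Measurable (w z) := hwm.comp (f := fun x => (z, x)) (by fun_prop)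
        have := (hF g hg).1
        have := (hF _ (hGF (huG n))).1
        unfold wsq
        fun_prop
      · have := wsq_mem (hw z x) ((hF g hg).2 x) ((hF _ (hGF (huG n))).2 x)
        rw [Real.norm_eq_abs, abs_of_nonneg this.1]
        exact this.2
    have hlim := (hint.const_mul (k : ℝ)).sub
      ((tendsto_finsetSum (Finset.range k) fun i _ => hpt (z (a + i)).1).const_mul 2)
    obtain ⟨n, hn⟩ := (hlim.eventually_const_lt hz).exists
    refine le_iSup₂_of_le (f := fun f (_ : f ∈ G) => ghostExp D w g a k 0 f z) (u n) (huG n) ?_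
    unfold ghostExp
    refine ENNReal.ofReal_le_ofReal (Real.exp_le_exp.2 ?_)
    simp only [Finset.range_zero, Finset.sum_empty, Nat.cast_zero, sub_zero, zero_add]
    linarith
  refine (measure_mono hsub).trans ((meas_ge_le_lintegral_div (hΘm 0).aemeasurable
    (by simp [Real.exp_pos]) ENNReal.ofReal_ne_top).trans ?_)
  refine ENNReal.div_le_of_le_mul ((hchain.trans hcover).trans (le_of_eq ?_))
  rw [mul_right_comm (ENNReal.ofReal (Real.exp ((6 - B) / 8))),
    ← ENNReal.ofReal_mul (Real.exp_pos _).le, ← Real.exp_add]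
  congr 3
  ring

end Ghost

/-! ### Concentration of the number of queries. -/

section Count

variable {X : Type*} [MeasurableSpace X] {D : Measure (X × Bool)} [IsProbabilityMeasure D]

/-- Uses `exp w ≤ 1 + 2 w` on the unit interval and `1 + 2 p ≤ exp (2 p)`. -/
theorem lintegral_exp_sub_two_mul_le (μ : Measure X) [IsProbabilityMeasure μ] {w : X → ℝ}
    (hm : Measurable w) (hw : ∀ x, w x ∈ Set.Icc (0 : ℝ) 1) :
    ∫⁻ x, ENNReal.ofReal (Real.exp (w x - 2 * ∫ y, w y ∂μ)) ∂μ ≤ 1 := by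
  have hi : Integrable w μ := Integrable.of_bound hm.aestronglyMeasurable 1
    (Eventually.of_forall fun x => by
      rw [Real.norm_eq_abs, abs_of_nonneg (hw x).1]; exact (hw x).2)
  set p := ∫ y, w y ∂μ with hp
  have hp0 : 0 ≤ p := integral_nonneg fun x => (hw x).1
  have hle : ∀ x, Real.exp (w x - 2 * p) ≤ (1 + 2 * w x) * Real.exp (-(2 * p)) := by
    intro x
    obtain ⟨h0, h1⟩ := hw x
    have e1 := (abs_le.1 (Real.abs_exp_sub_one_sub_id_le (x := w x)
      (by rw [abs_of_nonneg h0]; exact h1))).2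
    rw [sub_eq_add_neg, Real.exp_add]
    refine mul_le_mul_of_nonneg_right ?_ (Real.exp_pos _).le
    nlinarith
  have hint : Integrable (fun x => (1 + 2 * w x) * Real.exp (-(2 * p))) μ :=
    ((integrable_const 1).add (hi.const_mul 2)).mul_const _
  calc _ ≤ ∫⁻ x, ENNReal.ofReal ((1 + 2 * w x) * Real.exp (-(2 * p))) ∂μ :=
        lintegral_mono fun x => ENNReal.ofReal_le_ofReal (hle x)
    _ = ENNReal.ofReal ((1 + 2 * p) * Real.exp (-(2 * p))) := by
        rw [← ofReal_integral_eq_lintegral_ofReal hint (Eventually.of_forall fun x => by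
          have := (hw x).1
          positivity)]
        congr 1
        rw [integral_mul_const, integral_add (integrable_const 1) (hi.const_mul 2),
          integral_const_mul]
        simp [hp]
    _ ≤ 1 := by
        rw [ENNReal.ofReal_le_one, Real.exp_neg, ← div_eq_mul_inv, div_le_one (Real.exp_pos _)]
        linarith [Real.add_one_le_exp (2 * p)]

/-- Integrating out the latest point shows that the exponential of the partial sums has expectation
at most 1 at every time; Markov's inequality concludes. -/
theorem measure_count_gt_le {n : ℕ} {w : ℕ → (ℕ → X × Bool) → X → ℝ}
    (hwm : ∀ t < n, Measurable fun p : (ℕ → X × Bool) × X => w t p.1 p.2)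
    (hw : ∀ t z x, w t z x ∈ Set.Icc (0 : ℝ) 1)
    (hwi : ∀ t z z', (∀ s < t, z s = z' s) → w t z = w t z') (B : ℝ) :
    Measure.infinitePi (fun _ : ℕ => D)
      {z | B < ∑ t ∈ Finset.range n, (w t z (z t).1 - 2 * ∫ x, w t z x ∂D.fst)} ≤
      ENNReal.ofReal (Real.exp (-B)) := by
  set P := Measure.infinitePi (fun _ : ℕ => D) with hP
  have hqm : ∀ t < n, Measurable fun z : ℕ → X × Bool =>
      w t z (z t).1 - 2 * ∫ x, w t z x ∂D.fst := fun t ht => by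
    have h1 : Measurable fun z : ℕ → X × Bool => w t z (z t).1 :=
      (hwm t ht).comp (f := fun z : ℕ → X × Bool => (z, (z t).1)) (by fun_prop)
    have h2 : Measurable fun z : ℕ → X × Bool => ∫ x, w t z x ∂D.fst :=
      (hwm t ht).stronglyMeasurable.integral_prod_right'.measurable
    fun_prop
  have hΦm : ∀ k ≤ n, Measurable fun z : ℕ → X × Bool => ENNReal.ofReal (Real.exp
      (∑ t ∈ Finset.range k, (w t z (z t).1 - 2 * ∫ x, w t z x ∂D.fst))) := fun k hk =>
    (Real.measurable_exp.comp (Finset.measurable_sum _ fun t ht =>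
      hqm t ((Finset.mem_range.1 ht).trans_le hk))).ennreal_ofReal
  have hind : ∀ k ≤ n, ∫⁻ z, ENNReal.ofReal (Real.exp
      (∑ t ∈ Finset.range k, (w t z (z t).1 - 2 * ∫ x, w t z x ∂D.fst))) ∂P ≤ 1 := by
    intro k
    induction k with
    | zero => simp
    | succ k ih =>
      intro hk
      refine le_trans ?_ (ih (by omega))
      rw [hP, ← lintegral_resample D k (hΦm (k + 1) hk)]
      refine lintegral_mono fun z => ?_
      have hwu : ∀ t ≤ k, ∀ v, w t (Function.update z k v) = w t z := fun t ht v =>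
        hwi t _ _ fun s hs => by rw [Function.update_of_ne (by omega)]
      have h1 : ∀ v, ENNReal.ofReal (Real.exp (∑ t ∈ Finset.range (k + 1),
          (w t (Function.update z k v) (Function.update z k v t).1 -
            2 * ∫ x, w t (Function.update z k v) x ∂D.fst))) =
          ENNReal.ofReal (Real.exp (∑ t ∈ Finset.range k,
            (w t z (z t).1 - 2 * ∫ x, w t z x ∂D.fst))) *
          ENNReal.ofReal (Real.exp (w k z v.1 - 2 * ∫ x, w k z x ∂D.fst)) := by
        intro v
        rw [← ENNReal.ofReal_mul (Real.exp_pos _).le, ← Real.exp_add, Finset.sum_range_succ,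
          hwu k le_rfl, Function.update_self]
        congr 3
        refine Finset.sum_congr rfl fun t ht => ?_
        have := Finset.mem_range.1 ht
        rw [hwu t this.le, Function.update_of_ne this.ne]
      have hwz : Measurable (w k z) :=
        (hwm k (by omega)).comp (f := fun x => (z, x)) (by fun_prop)
      simp only [h1]
      rw [lintegral_const_mul _ (by fun_prop)]
      refine mul_le_of_le_one_right' (le_trans (le_of_eq ?_)
        (lintegral_exp_sub_two_mul_le D.fst hwz (hw k z)))
      conv_rhs => rw [Measure.fst, lintegral_map (by fun_prop) measurable_fst]
      rfl
  have hsub : {z | B < ∑ t ∈ Finset.range n, (w t z (z t).1 - 2 * ∫ x, w t z x ∂D.fst)} ⊆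
      {z | ENNReal.ofReal (Real.exp B) ≤ ENNReal.ofReal (Real.exp
      (∑ t ∈ Finset.range n, (w t z (z t).1 - 2 * ∫ x, w t z x ∂D.fst)))} := fun z hz =>
    ENNReal.ofReal_le_ofReal (Real.exp_le_exp.2 (le_of_lt hz))
  refine (measure_mono hsub).trans ((meas_ge_le_lintegral_div (hΦm n le_rfl).aemeasurable
    (by simp [Real.exp_pos]) ENNReal.ofReal_ne_top).trans ?_)
  refine ENNReal.div_le_of_le_mul ((hind n le_rfl).trans (le_of_eq ?_))
  rw [← ENNReal.ofReal_mul (Real.exp_pos _).le, ← Real.exp_add]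
  simp

end Count

/-! ### Epochs, confidence bounds and the active sets. -/

theorem tau_succ_le (m : ℕ) : tau m ≤ tau (m + 1) := by
  by_cases h : m = 0
  · simp [tau, h]
  · simp only [tau, h, if_false, Nat.succ_ne_zero]
    exact Nat.pow_le_pow_right (by norm_num) (Nat.le_succ m)

theorem tau_mono : Monotone tau := monotone_nat_of_le_succ tau_succ_le

theorem tau_succ (m : ℕ) : tau (m + 1) = 2 ^ (m + 1) := by simp [tau]

theorem tau_log_le (t : ℕ) : tau (Nat.log 2 t) ≤ t := by
  unfold tau
  split_ifs with h
  · exact Nat.zero_le t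
  · refine Nat.pow_log_le_self 2 ?_
    rintro rfl
    simp at h

/-- Index `t`, counted from 0, belongs to epoch `Nat.log 2 t + 1`. Both 0 and 1 have logarithm 0,
which matches a first epoch of length 2. -/
theorem log_eq_of_tau_le {m t : ℕ} (h1 : tau m ≤ t) (h2 : t < tau (m + 1)) : Nat.log 2 t = m := by
  rw [tau_succ] at h2
  by_cases hm : m = 0
  · subst hm
    exact Nat.log_of_lt (by simpa using h2)
  · rw [Nat.log_eq_iff (Or.inl hm)]
    exact ⟨by simpa [tau, hm] using h1, h2⟩

section Bounds

variable {X : Type*} {F A A' : Set (X → ℝ)}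

theorem lcb_le (hF : ∀ f ∈ F, ∀ x, f x ∈ Set.Icc (0 : ℝ) 1) (hA : A ⊆ F) {f : X → ℝ}
    (hf : f ∈ A) (x : X) : lcb A x ≤ f x :=
  ciInf_le (f := fun f : A => (f : X → ℝ) x)
    ⟨0, by rintro _ ⟨f, rfl⟩; exact (hF f (hA f.2) x).1⟩ ⟨f, hf⟩

theorem le_ucb (hF : ∀ f ∈ F, ∀ x, f x ∈ Set.Icc (0 : ℝ) 1) (hA : A ⊆ F) {f : X → ℝ}
    (hf : f ∈ A) (x : X) : f x ≤ ucb A x :=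
  le_ciSup (f := fun f : A => (f : X → ℝ) x)
    ⟨1, by rintro _ ⟨f, rfl⟩; exact (hF f (hA f.2) x).2⟩ ⟨f, hf⟩

theorem exists_lt_of_lcb_lt (hA : A.Nonempty) {x : X} {c : ℝ} (h : lcb A x < c) :
    ∃ f ∈ A, f x < c := by
  have := hA.to_subtype
  obtain ⟨f, hf⟩ := exists_lt_of_ciInf_lt h
  exact ⟨f, f.2, hf⟩

theorem exists_lt_of_lt_ucb (hA : A.Nonempty) {x : X} {c : ℝ} (h : c < ucb A x) :
    ∃ f ∈ A, c < f x := by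
  have := hA.to_subtype
  obtain ⟨f, hf⟩ := exists_lt_of_lt_ciSup h
  exact ⟨f, f.2, hf⟩

theorem lcb_anti (hF : ∀ f ∈ F, ∀ x, f x ∈ Set.Icc (0 : ℝ) 1) (hA : A ⊆ F) (hA' : A'.Nonempty)
    (h : A' ⊆ A) (x : X) : lcb A x ≤ lcb A' x := by
  have := hA'.to_subtype
  exact le_ciInf fun f => lcb_le hF hA (h f.2) x

theorem ucb_mono (hF : ∀ f ∈ F, ∀ x, f x ∈ Set.Icc (0 : ℝ) 1) (hA : A ⊆ F) (hA' : A'.Nonempty)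
    (h : A' ⊆ A) (x : X) : ucb A' x ≤ ucb A x := by
  have := hA'.to_subtype
  exact ciSup_le fun f => le_ucb hF hA (h f.2) x

end Bounds

namespace Input

variable {X : Type*} (I : Input X)

/-- The active set of epoch `m`. -/
def epochSet (m : ℕ) (z : ℕ → X × Bool) : Set (X → ℝ) :=
  I.activeSet (I.history (m - 1) z) (I.β m)

theorem activeSet_subset (S : List (X × Bool)) (b : ℝ) : I.activeSet S b ⊆ I.F := fun _ h => h.1

theorem classifier_eq_none_iff (S : List (X × Bool)) (b : ℝ) (x : X) :
    I.classifier S b x = none ↔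
      Set.Icc (lcb (I.activeSet S b) x) (ucb (I.activeSet S b) x) ⊆
        Set.Icc (1 / 2 - I.γ) (1 / 2 + I.γ) := by
  unfold classifier
  split_ifs <;> simp_all

theorem query_eq_true_iff (S : List (X × Bool)) (b : ℝ) (x : X) :
    I.query S b x = true ↔
      (1 / 2 : ℝ) ∈ Set.Ioo (lcb (I.activeSet S b) x) (ucb (I.activeSet S b) x) ∧
      ¬ Set.Icc (lcb (I.activeSet S b) x) (ucb (I.activeSet S b) x) ⊆
        Set.Icc (1 / 2 - I.γ) (1 / 2 + I.γ) := by
  rw [← I.classifier_eq_none_iff]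
  simp [query]

theorem query_mono (hF : ∀ f ∈ I.F, ∀ x, f x ∈ Set.Icc (0 : ℝ) 1) {S S' : List (X × Bool)}
    {b b' : ℝ} (hne : (I.activeSet S' b').Nonempty) (h : I.activeSet S' b' ⊆ I.activeSet S b)
    {x : X} (hq : I.query S' b' x = true) : I.query S b x = true := by
  rw [query_eq_true_iff] at hq ⊢
  have h1 := lcb_anti hF (I.activeSet_subset S b) hne h x
  have h2 := ucb_mono hF (I.activeSet_subset S b) hne h x
  exact ⟨⟨h1.trans_lt hq.1.1, hq.1.2.trans_le h2⟩,
    fun hs => hq.2 ((Set.Icc_subset_Icc h1 h2).trans hs)⟩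

/-- The interval contains `1/2` but leaves the band of radius `γ`, so it is longer than `γ`, and one
of its ends is further than `γ / 2` from `g x`. This is the source of the parameter `γ / 2` in the
disagreement coefficient. -/
theorem exists_gap_of_query (hF : ∀ f ∈ I.F, ∀ x, f x ∈ Set.Icc (0 : ℝ) 1)
    {S : List (X × Bool)} {b : ℝ} {g : X → ℝ} (hg : g ∈ I.activeSet S b) {x : X}
    (hq : I.query S b x = true) : ∃ f ∈ I.activeSet S b, I.γ / 2 < |f x - g x| := by
  rw [query_eq_true_iff] at hq
  have hne : (I.activeSet S b).Nonempty := ⟨g, hg⟩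
  have h1 := lcb_le hF (I.activeSet_subset S b) hg x
  have h2 := le_ucb hF (I.activeSet_subset S b) hg x
  have h3 : I.γ < ucb (I.activeSet S b) x - lcb (I.activeSet S b) x := by
    by_contra! h
    exact hq.2 (Set.Icc_subset_Icc (by linarith [hq.1.2]) (by linarith [hq.1.1]))
  by_cases h4 : I.γ / 2 < ucb (I.activeSet S b) x - g x
  · obtain ⟨f, hf, hlt⟩ := exists_lt_of_lt_ucb hne
      (show I.γ / 2 + g x < ucb (I.activeSet S b) x by linarith)
    exact ⟨f, hf, lt_of_lt_of_le (by linarith) (le_abs_self _)⟩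
  · obtain ⟨f, hf, hlt⟩ := exists_lt_of_lcb_lt hne
      (show lcb (I.activeSet S b) x < g x - I.γ / 2 by linarith)
    exact ⟨f, hf, lt_of_lt_of_le (by linarith) (neg_le_abs _)⟩

/-! ### The history as a sum over time -/

theorem history_congr {m : ℕ} {z z' : ℕ → X × Bool} (h : ∀ t < tau m, z t = z' t) :
    I.history m z = I.history m z' := by
  induction m with
  | zero => rfl
  | succ m ih =>
    have hm := ih fun t ht => h t (ht.trans_le (tau_succ_le m))
    simp only [history, hm]
    congr 2
    refine List.map_congr_left fun t ht => h t ?_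
    have := List.mem_range'_1.1 ht
    have := tau_succ_le m
    omega

theorem epochQuery_congr {m : ℕ} {z z' : ℕ → X × Bool} (h : ∀ t < tau (m - 1), z t = z' t) :
    I.epochQuery m z = I.epochQuery m z' := by
  simp only [epochQuery, I.history_congr h]

/-- The indicator that the query function of epoch `m` is `1` at `x`. -/
noncomputable def queryInd (m : ℕ) (z : ℕ → X × Bool) (x : X) : ℝ := if I.epochQuery m z x then 1 else 0

theorem queryInd_mem (m : ℕ) (z : ℕ → X × Bool) (x : X) :
    I.queryInd m z x ∈ Set.Icc (0 : ℝ) 1 := by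
  unfold queryInd
  split_ifs <;> simp

theorem queryInd_congr {m : ℕ} {z z' : ℕ → X × Bool} (h : ∀ t < tau (m - 1), z t = z' t) :
    I.queryInd m z = I.queryInd m z' := by
  funext x
  simp only [queryInd, I.epochQuery_congr h]

/-- The indicator that the label of the data point at time `t` is queried. -/
noncomputable def queried (t : ℕ) (z : ℕ → X × Bool) : ℝ := I.queryInd (Nat.log 2 t + 1) z (z t).1

theorem queried_mem (t : ℕ) (z : ℕ → X × Bool) : I.queried t z ∈ Set.Icc (0 : ℝ) 1 :=
  I.queryInd_mem _ _ _

theorem queried_eq {m t : ℕ} (h1 : tau m ≤ t) (h2 : t < tau (m + 1)) (z : ℕ → X × Bool) :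
    I.queried t z = I.queryInd (m + 1) z (z t).1 := by
  rw [queried, log_eq_of_tau_le h1 h2]

/-- The decision at time `s` uses only labels from earlier epochs, so a label at time `t ≥ s` cannot
influence it, even when `s = t`. -/
theorem queried_update {t s : ℕ} (hs : s ≤ t) (z : ℕ → X × Bool) (b : Bool) :
    I.queried s (Function.update z t ((z t).1, b)) = I.queried s z := by
  unfold queried
  rw [I.queryInd_congr (z' := z)]
  · congr 1
    by_cases h : s = t
    · subst h; simp
    · simp [h]
  · intro i hi
    have := tau_log_le s
    rw [Nat.add_sub_cancel] at hi
    rw [Function.update_of_ne (by omega)]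

theorem sum_map_filter {α : Type*} (p : α → Bool) (φ : α → ℝ) (l : List α) :
    ((l.filter p).map φ).sum = (l.map fun a => (if p a then 1 else 0) * φ a).sum := by
  induction l with
  | nil => rfl
  | cons a l ih =>
    by_cases h : p a <;> simp [h, ih]

theorem sum_map_range' (φ : ℕ → ℝ) (a k : ℕ) :
    ((List.range' a k).map φ).sum = ∑ t ∈ Finset.Ico a (a + k), φ t := by
  induction k with
  | zero => simp
  | succ k ih =>
    rw [← add_assoc, Finset.sum_Ico_succ_top (by omega), ← ih, List.range'_concat]
    simp

theorem sum_history (φ : X × Bool → ℝ) (m : ℕ) (z : ℕ → X × Bool) :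
    ((I.history m z).map φ).sum = ∑ t ∈ Finset.Ico 0 (tau m), I.queried t z * φ (z t) := by
  induction m with
  | zero => simp [history, tau]
  | succ m ih =>
    have hle := tau_succ_le m
    rw [← Finset.sum_Ico_consecutive _ (Nat.zero_le _) hle, ← ih]
    simp only [history, List.map_append, List.sum_append]
    congr 1
    rw [sum_map_filter, List.map_map, sum_map_range', Nat.add_sub_cancel' hle]
    refine Finset.sum_congr rfl fun t ht => ?_
    rw [Finset.mem_Ico] at ht
    rw [I.queried_eq ht.1 ht.2]
    rfl

theorem length_history (m : ℕ) (z : ℕ → X × Bool) :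
    ((I.history m z).length : ℝ) = ∑ t ∈ Finset.Ico 0 (tau m), I.queried t z := by
  have := I.sum_history (fun _ => 1) m z
  simpa using this

/-- The increment of the difference of the squared losses of `f` and `g` over a time interval. -/
noncomputable def lossDiff (g f : X → ℝ) (a b : ℕ) (z : ℕ → X × Bool) : ℝ :=
  ∑ t ∈ Finset.Ico a b, I.queried t z *
    ((f (z t).1 - labelValue (z t).2) ^ 2 - (g (z t).1 - labelValue (z t).2) ^ 2)

theorem sqLoss_sub_sqLoss (g f : X → ℝ) (m : ℕ) (z : ℕ → X × Bool) :
    sqLoss f (I.history m z) - sqLoss g (I.history m z) = I.lossDiff g f 0 (tau m) z := by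
  unfold sqLoss lossDiff
  rw [I.sum_history (fun p => (f p.1 - labelValue p.2) ^ 2),
    I.sum_history (fun p => (g p.1 - labelValue p.2) ^ 2), ← Finset.sum_sub_distrib]
  exact Finset.sum_congr rfl fun t _ => by ring

/-- The loss increment plus the noise term equals `q` times `(f - g)² / 2 + 2 (f - g)(g - η)`, and
completing the square bounds the bracket below by `(f - g)² / 4 - 4 (g - η)²`. -/
theorem sq_sum_le_lossDiff {η g f : X → ℝ} {κ : ℝ} (hκ : ∀ x, |g x - η x| ≤ κ)
    {a b : ℕ} (z : ℕ → X × Bool) :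
    (∑ t ∈ Finset.Ico a b, I.queried t z * (f (z t).1 - g (z t).1) ^ 2) / 4 ≤
      I.lossDiff g f a b z + 4 * κ ^ 2 * (b - a : ℕ) +
        ∑ t ∈ Finset.Ico a b, noiseTerm η g f (I.queried t z) (z t) := by
  unfold lossDiff
  rw [Finset.sum_div, ← Nat.card_Ico, mul_comm (4 * κ ^ 2), ← nsmul_eq_mul, ← Finset.sum_const,
    ← Finset.sum_add_distrib, ← Finset.sum_add_distrib]
  refine Finset.sum_le_sum fun t _ => ?_
  obtain ⟨h0, h1⟩ := I.queried_mem t z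
  have h2 := abs_le.1 (hκ (z t).1)
  unfold noiseTerm
  generalize I.queried t z = q at *
  generalize f (z t).1 = b at *
  generalize g (z t).1 = a at *
  generalize η (z t).1 = e at *
  generalize labelValue (z t).2 = y at *
  have h3 : 0 ≤ ((b - a) / 2 + 2 * (a - e)) ^ 2 := sq_nonneg _
  have h4 : (a - e) ^ 2 ≤ κ ^ 2 := sq_le_sq' h2.1 h2.2
  have h5 : q * (a - e) ^ 2 ≤ κ ^ 2 := (mul_le_of_le_one_left (sq_nonneg _) h1).trans h4
  have h6 := mul_nonneg h0 h3
  nlinarith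

/-- The squared differences to `g` on the queried points are controlled by the differences of the
squared losses. -/
def Controlled (g : X → ℝ) (z : ℕ → X × Bool) : Prop :=
  ∀ f ∈ I.F, ∀ a b : ℕ, (∃ m, m + 1 ≤ I.M ∧ a = 0 ∧ b = tau m) ∨
      (∃ m, m + 2 ≤ I.M ∧ a = tau m ∧ b = tau (m + 1)) →
    (∑ t ∈ Finset.Ico a b, I.queried t z * (f (z t).1 - g (z t).1) ^ 2) / 4 ≤
      I.lossDiff g f a b z + I.Cδ

theorem two_Cδ_le_β (hC : 0 ≤ I.Cδ) {m : ℕ} (hm : m ≤ I.M) : 2 * I.Cδ ≤ I.β m := by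
  have hm' : (m : ℝ) ≤ I.M := by exact_mod_cast hm
  have h1 : (0 : ℝ) ≤ 2 * I.ε ^ 2 * (tau (I.M - 1) : ℝ) := by positivity
  unfold β
  nlinarith

theorem β_succ_add_le (m : ℕ) : I.β (m + 1) + 2 * I.Cδ ≤ I.β m := by
  have h1 : (0 : ℝ) ≤ 2 * I.ε ^ 2 * (tau (I.M - 1) : ℝ) := by positivity
  unfold β
  push_cast
  nlinarith

theorem β_le_β_one (hC : 0 ≤ I.Cδ) {m : ℕ} (hm : 1 ≤ m) : I.β m ≤ I.β 1 := by
  induction m, hm using Nat.le_induction with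
  | base => exact le_rfl
  | succ m _ ih => linarith [I.β_succ_add_le m]

variable {I}

/-- Applied to the oracle output, `Controlled` says that `g` is within `C_δ` of the minimal loss. -/
theorem mem_epochSet (hor : IsRegressionOracle I.F I.oracle) (hC : 0 ≤ I.Cδ) {g : X → ℝ}
    (hg : g ∈ I.F) {z : ℕ → X × Bool} (hz : I.Controlled g z) {m : ℕ} (h1 : 1 ≤ m)
    (hm : m ≤ I.M) : g ∈ I.epochSet m z := by
  obtain ⟨m, rfl⟩ := Nat.exists_eq_add_of_le' h1
  refine ⟨hg, ?_⟩
  rw [Nat.add_sub_cancel]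
  have h2 := hz _ (hor (I.history m z)).1 0 (tau m) (Or.inl ⟨m, hm, rfl, rfl⟩)
  rw [← I.sqLoss_sub_sqLoss] at h2
  have h3 : 0 ≤ ∑ t ∈ Finset.Ico 0 (tau m), I.queried t z *
      (I.oracle (I.history m z) (z t).1 - g (z t).1) ^ 2 :=
    Finset.sum_nonneg fun t _ => mul_nonneg (I.queried_mem t z).1 (sq_nonneg _)
  linarith [I.two_Cδ_le_β hC hm]

/-- Going back one epoch loses `C_δ` because the loss increment of `f` relative to `g` is at least
`-C_δ`, and another `C_δ` for comparing `g` with the earlier minimizer. The decrease of `β` pays for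
both. -/
theorem epochSet_succ_subset (hor : IsRegressionOracle I.F I.oracle)
    {g : X → ℝ} (hg : g ∈ I.F) {z : ℕ → X × Bool} (hz : I.Controlled g z) {m : ℕ} (h1 : 1 ≤ m)
    (hm : m + 1 ≤ I.M) : I.epochSet (m + 1) z ⊆ I.epochSet m z := by
  obtain ⟨m, rfl⟩ := Nat.exists_eq_add_of_le' h1
  rintro f ⟨hf, hL⟩
  refine ⟨hf, ?_⟩
  rw [Nat.add_sub_cancel] at hL ⊢
  have ha := hz f hf (tau m) (tau (m + 1)) (Or.inr ⟨m, by omega, rfl, rfl⟩)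
  have hb := hz _ (hor (I.history m z)).1 0 (tau m) (Or.inl ⟨m, by omega, rfl, rfl⟩)
  have hor' := (hor (I.history (m + 1) z)).2 g hg
  have hs : I.lossDiff g f 0 (tau m) z + I.lossDiff g f (tau m) (tau (m + 1)) z =
      I.lossDiff g f 0 (tau (m + 1)) z :=
    Finset.sum_Ico_consecutive _ (Nat.zero_le _) (tau_succ_le m)
  rw [← I.sqLoss_sub_sqLoss] at hb
  rw [← I.sqLoss_sub_sqLoss, ← I.sqLoss_sub_sqLoss] at hs
  have h3 : 0 ≤ ∑ t ∈ Finset.Ico 0 (tau m), I.queried t z *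
      (I.oracle (I.history m z) (z t).1 - g (z t).1) ^ 2 :=
    Finset.sum_nonneg fun t _ => mul_nonneg (I.queried_mem t z).1 (sq_nonneg _)
  have h4 : 0 ≤ ∑ t ∈ Finset.Ico (tau m) (tau (m + 1)), I.queried t z *
      (f (z t).1 - g (z t).1) ^ 2 :=
    Finset.sum_nonneg fun t _ => mul_nonneg (I.queried_mem t z).1 (sq_nonneg _)
  linarith [I.β_succ_add_le (m + 1)]

theorem epochQuery_anti (hF : ∀ f ∈ I.F, ∀ x, f x ∈ Set.Icc (0 : ℝ) 1)
    (hor : IsRegressionOracle I.F I.oracle) (hC : 0 ≤ I.Cδ)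
    {g : X → ℝ} (hg : g ∈ I.F) {z : ℕ → X × Bool} (hz : I.Controlled g z) {m : ℕ} (h1 : 1 ≤ m)
    (hm : m + 1 ≤ I.M) {x : X} (hq : I.epochQuery (m + 1) z x = true) :
    I.epochQuery m z x = true :=
  I.query_mono hF ⟨g, mem_epochSet hor hC hg hz (Nat.le_add_left 1 m) hm⟩
    (epochSet_succ_subset hor hg hz h1 hm) hq

theorem sum_sq_le_of_mem_epochSet (hor : IsRegressionOracle I.F I.oracle) (hC : 0 ≤ I.Cδ)
    {g : X → ℝ} (hg : g ∈ I.F) {z : ℕ → X × Bool} (hz : I.Controlled g z) {m : ℕ}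
    (hm : m + 2 ≤ I.M) {f : X → ℝ} (hf : f ∈ I.epochSet (m + 2) z) :
    ∑ i ∈ Finset.range (tau (m + 1) - tau m),
      wsq (I.queryInd (m + 1) z) g f (z (tau m + i)).1 ≤ 6 * I.β (m + 2) := by
  obtain ⟨hfF, hL⟩ := hf
  rw [show m + 2 - 1 = m + 1 by omega] at hL
  have ha := hz f hfF 0 (tau (m + 1)) (Or.inl ⟨m + 1, by omega, rfl, rfl⟩)
  have hor' := (hor (I.history (m + 1) z)).2 g hg
  rw [← I.sqLoss_sub_sqLoss] at ha
  have h2 := I.two_Cδ_le_β hC hm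
  have hle : ∑ t ∈ Finset.Ico (tau m) (tau (m + 1)), I.queried t z * (f (z t).1 - g (z t).1) ^ 2 ≤
      ∑ t ∈ Finset.Ico 0 (tau (m + 1)), I.queried t z * (f (z t).1 - g (z t).1) ^ 2 :=
    Finset.sum_le_sum_of_subset_of_nonneg (Finset.Ico_subset_Ico_left (Nat.zero_le _))
      fun t _ _ => mul_nonneg (I.queried_mem t z).1 (sq_nonneg _)
  have heq : ∑ i ∈ Finset.range (tau (m + 1) - tau m),
      wsq (I.queryInd (m + 1) z) g f (z (tau m + i)).1 =
      ∑ t ∈ Finset.Ico (tau m) (tau (m + 1)), I.queried t z * (f (z t).1 - g (z t).1) ^ 2 := by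
    rw [Finset.sum_Ico_eq_sum_range]
    refine Finset.sum_congr rfl fun i hi => ?_
    have := Finset.mem_range.1 hi
    rw [I.queried_eq (m := m) (by omega) (by omega)]
    rfl
  rw [heq]
  -- One quarter of the sum is at most `β + C_δ ≤ 3 β / 2`, hence the constant 6.
  linarith

end Input

/-! ### From mean squared distance to the probability of a region. -/

section Disagreement

variable {X : Type*} [MeasurableSpace X]

theorem one_le_valDisagreementSup (F : Set (X → ℝ)) (g : X → ℝ) (γ₀ : ℝ) :
    1 ≤ valDisagreementSup F g γ₀ :=
  le_iSup₂_of_le (f := fun (ι : ℝ) (_ : 0 < ι) => valDisagreement F g γ₀ ι) 1 one_pos le_sup_right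

theorem mul_measure_le_valDisagreementSup (F : Set (X → ℝ)) (g : X → ℝ) {γ₀ γ ε : ℝ} (hγ : γ₀ < γ)
    (hε : 0 < ε) (μ : Measure X) [hμ : IsProbabilityMeasure μ] :
    ENNReal.ofReal (γ ^ 2 / ε ^ 2) *
      μ {x | ∃ f ∈ F, γ < |f x - g x| ∧ Real.sqrt (∫ z, (f z - g z) ^ 2 ∂μ) ≤ ε} ≤
      valDisagreementSup F g γ₀ := by
  refine le_iSup₂_of_le (f := fun (ι : ℝ) (_ : 0 < ι) => valDisagreement F g γ₀ ι) (ε / 2)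
    (by positivity) (le_trans ?_ le_sup_left)
  refine le_iSup_of_le μ (le_iSup_of_le hμ (le_iSup_of_le γ (le_iSup_of_le hγ
    (le_iSup_of_le ε (le_iSup_of_le (by linarith) le_rfl)))))

/-- The test measure is `P` conditioned on `A`: all of `A` is disagreement region, with squared
radius `s / P A`, so the coefficient is at least `γ₀² P A / s`. -/
theorem measure_le_valDisagreementSup (P : Measure X) [IsProbabilityMeasure P] {F V : Set (X → ℝ)}
    (hV : V ⊆ F) {g : X → ℝ} {A : Set X} {s γ₀ : ℝ} (hs : 0 < s)
    (hγ₀ : 0 < γ₀) (h1 : ∀ f ∈ V, ∫ x in A, (f x - g x) ^ 2 ∂P ≤ s)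
    (h2 : ∀ x ∈ A, ∃ f ∈ V, γ₀ < |f x - g x|) :
    P A ≤ ENNReal.ofReal (s / γ₀ ^ 2) * valDisagreementSup F g γ₀ := by
  by_cases hp : P A = 0
  · simp [hp]
  have hpt : P A ≠ ⊤ := measure_ne_top _ _
  have hpr : 0 < (P A).toReal := ENNReal.toReal_pos hp hpt
  set μ := ProbabilityTheory.cond P A with hμ
  have : IsProbabilityMeasure μ := ProbabilityTheory.cond_isProbabilityMeasure hp
  set ε := Real.sqrt (s / (P A).toReal) with hε
  have hε0 : 0 < ε := Real.sqrt_pos.2 (by positivity)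
  have hε2 : ε ^ 2 = s / (P A).toReal := Real.sq_sqrt (by positivity)
  have hnorm : ∀ f ∈ V, Real.sqrt (∫ z, (f z - g z) ^ 2 ∂μ) ≤ ε := by
    intro f hf
    refine Real.sqrt_le_sqrt ?_
    rw [hμ, ProbabilityTheory.cond, integral_smul_measure, smul_eq_mul, ENNReal.toReal_inv,
      inv_mul_eq_div]
    exact div_le_div_of_nonneg_right (h1 f hf) hpr.le
  -- The definition requires thresholds strictly above `γ₀`, so `A` is exhausted by the regions with
  -- thresholds `γ₀ + 1 / (n + 1)`.
  let U : ℕ → Set X := fun n => {x | ∃ f ∈ F, γ₀ + 1 / ((n : ℝ) + 1) < |f x - g x| ∧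
    Real.sqrt (∫ z, (f z - g z) ^ 2 ∂μ) ≤ ε}
  have hUm : Monotone U := by
    rintro n m hnm x ⟨f, hf, hlt, hle⟩
    exact ⟨f, hf, lt_of_le_of_lt (by gcongr) hlt, hle⟩
  have hAU : A ⊆ ⋃ n, U n := by
    intro x hx
    obtain ⟨f, hf, hlt⟩ := h2 x hx
    obtain ⟨n, hn⟩ := exists_nat_one_div_lt (sub_pos.2 hlt)
    exact Set.mem_iUnion.2 ⟨n, f, hV hf, by linarith, hnorm f hf⟩
  have hμA : μ A = 1 := ProbabilityTheory.cond_apply_self hp hpt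
  have hb : ∀ n, ENNReal.ofReal (γ₀ ^ 2 / ε ^ 2) * μ (U n) ≤ valDisagreementSup F g γ₀ := by
    intro n
    have h3 : (0 : ℝ) < 1 / ((n : ℝ) + 1) := by positivity
    refine le_trans ?_ (mul_measure_le_valDisagreementSup F g (lt_add_of_pos_right γ₀ h3) hε0 μ)
    gcongr
    linarith
  have hle : ENNReal.ofReal (γ₀ ^ 2 / ε ^ 2) ≤ valDisagreementSup F g γ₀ := by
    calc ENNReal.ofReal (γ₀ ^ 2 / ε ^ 2) = ENNReal.ofReal (γ₀ ^ 2 / ε ^ 2) * μ A := by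
          rw [hμA, mul_one]
      _ ≤ ENNReal.ofReal (γ₀ ^ 2 / ε ^ 2) * μ (⋃ n, U n) := by gcongr
      _ = ⨆ n, ENNReal.ofReal (γ₀ ^ 2 / ε ^ 2) * μ (U n) := by
          rw [hUm.measure_iUnion, ENNReal.mul_iSup]
      _ ≤ _ := iSup_le hb
  calc P A = ENNReal.ofReal (s / γ₀ ^ 2) * ENNReal.ofReal (γ₀ ^ 2 / ε ^ 2) := by
        rw [← ENNReal.ofReal_mul (by positivity), hε2, ← ENNReal.ofReal_toReal hpt]
        congr 1
        rw [ENNReal.toReal_ofReal hpr.le]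
        field_simp
    _ ≤ _ := by gcongr

end Disagreement

/-! ### Chow's excess error, pointwise and integrated. -/

section Chow

variable {X : Type*}

/-- The conditional Chow error of a prediction, when the conditional probability of the label
`true` is `q`. -/
noncomputable def predictionCost (γ q : ℝ) : Option Bool → ℝ
  | none => 1 / 2 - γ
  | some b => 1 - labelProb q b

/-- If it abstains, `g x` is in the band, so `|η x - 1/2| ≤ γ + κ` and abstaining loses at most `κ`.
If it predicts without querying, the prediction agrees with the side of `g x`, so a disagreement
with Bayes costs at most `2κ`. On the query region a disagreement costs at most twice the distance
from the oracle value to `η x`. -/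
theorem Input.predictionCost_classifier_le {I : Input X}
    (hF : ∀ f ∈ I.F, ∀ x, f x ∈ Set.Icc (0 : ℝ) 1) {S : List (X × Bool)} {b : ℝ}
    (ho : I.oracle S ∈ I.activeSet S b) {g η : X → ℝ} (hg : g ∈ I.activeSet S b) {κ : ℝ}
    (hκ : ∀ x, |g x - η x| ≤ κ) (hγ : 0 < I.γ) (x : X) :
    predictionCost I.γ (η x) (I.classifier S b x) -
        predictionCost I.γ (η x) (some (bayes η x)) ≤
      2 * κ + (if I.query S b x then 1 else 0) * (2 * |I.oracle S x - g x|) := by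
  have hk := abs_le.1 (hκ x)
  have hκ0 : 0 ≤ κ := (abs_nonneg _).trans (hκ x)
  have g1 := lcb_le hF (I.activeSet_subset S b) hg x
  have g2 := le_ucb hF (I.activeSet_subset S b) hg x
  have o1 := lcb_le hF (I.activeSet_subset S b) ho x
  have o2 := le_ucb hF (I.activeSet_subset S b) ho x
  have a1 := le_abs_self (I.oracle S x - g x)
  have a2 := neg_le_abs (I.oracle S x - g x)
  have hbayes : predictionCost I.γ (η x) (some (bayes η x)) =
      if 1 / 2 ≤ η x then 1 - η x else η x := by
    by_cases h : 1 / 2 ≤ η x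
    · simp only [predictionCost, bayes, h, decide_true, labelProb, if_true]
    · simp only [predictionCost, bayes, h, decide_false, labelProb, Bool.false_eq_true, if_false,
        sub_sub_cancel]
  rw [hbayes]
  by_cases hnone : I.classifier S b x = none
  · have hsub := (I.classifier_eq_none_iff S b x).1 hnone
    have hgm := hsub ⟨g1, g2⟩
    have h0 : 0 ≤ (if I.query S b x then (1 : ℝ) else 0) * (2 * |I.oracle S x - g x|) := by
      split_ifs <;> positivity
    rw [hnone]
    simp only [predictionCost]
    split_ifs at * <;> linarith [hgm.1, hgm.2]
  · have hnsub := mt (I.classifier_eq_none_iff S b x).2 hnone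
    have htrue : I.classifier S b x = some true → 1 / 2 ≤ I.oracle S x ∧
        1 / 2 < ucb (I.activeSet S b) x := by
      intro h
      unfold classifier at h
      split_ifs at h with c1 c2 c3 c4
      · exact ⟨c2.le, c2.trans_le o2⟩
      · simp at h
      · simp at h
      · exact ⟨not_lt.1 c3, not_le.1 c4⟩
    have hfalse : I.classifier S b x = some false → I.oracle S x ≤ 1 / 2 ∧
        (I.oracle S x < 1 / 2 ∨ ucb (I.activeSet S b) x ≤ 1 / 2) := by
      intro h
      unfold classifier at h
      split_ifs at h with c1 c2 c3 c4
      · simp at h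
      · exact ⟨c3.le, Or.inl c3⟩
      · exact ⟨not_lt.1 c2, Or.inr c4⟩
      · simp at h
    have hquery : ¬ I.query S b x = true → 1 / 2 ≤ lcb (I.activeSet S b) x ∨
        ucb (I.activeSet S b) x ≤ 1 / 2 := by
      intro h
      rw [I.query_eq_true_iff] at h
      by_contra! hc
      exact h ⟨⟨hc.1, hc.2⟩, hnsub⟩
    obtain ⟨c, hc⟩ := Option.ne_none_iff_exists'.1 hnone
    rw [hc]
    by_cases hq : I.query S b x = true
    · rw [if_pos hq, one_mul]
      cases c
      · have := hfalse hc
        simp only [predictionCost, labelProb, Bool.false_eq_true, if_false]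
        split_ifs <;> linarith
      · have := htrue hc
        simp only [predictionCost, labelProb, if_true]
        split_ifs <;> linarith
    · rw [if_neg hq, zero_mul, add_zero]
      cases c
      · have h3 := hfalse hc
        simp only [predictionCost, labelProb, Bool.false_eq_true, if_false]
        rcases hquery hq with h4 | h4
        · exfalso
          rcases h3.2 with h5 | h5
          · linarith
          -- The interval would reduce to the single point `1/2`, where the classifier abstains.
          · exact hnsub (Set.Icc_subset_Icc (by linarith) (by linarith))
        · split_ifs <;> linarith
      · have h3 := htrue hc
        simp only [predictionCost, labelProb, if_true]
        rcases hquery hq with h4 | h4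
        · split_ifs <;> linarith
        · linarith [h3.2]

variable [MeasurableSpace X] {D : Measure (X × Bool)} [IsProbabilityMeasure D] {η : X → ℝ}

theorem IsCondProb.measureReal_eq (hη : IsCondProb D η) {S : Set (X × Bool)}
    (hS : MeasurableSet S) :
    Integrable (fun x => labelProb (η x) true * S.indicator 1 (x, true) +
      labelProb (η x) false * S.indicator 1 (x, false)) D.fst ∧
    D.real S = ∫ x, (labelProb (η x) true * S.indicator 1 (x, true) +
      labelProb (η x) false * S.indicator 1 (x, false)) ∂D.fst := by
  have hi : ∀ p, S.indicator (1 : X × Bool → ℝ) p ∈ Set.Icc (0 : ℝ) 1 := by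
    intro p
    by_cases hp : p ∈ S <;> simp [hp]
  have hnn : ∀ x, 0 ≤ labelProb (η x) true * S.indicator (1 : X × Bool → ℝ) (x, true) +
      labelProb (η x) false * S.indicator (1 : X × Bool → ℝ) (x, false) := fun x =>
    add_nonneg (mul_nonneg (hη.labelProb_mem _ x).1 (hi _).1)
      (mul_nonneg (hη.labelProb_mem _ x).1 (hi _).1)
  have hm : Measurable fun x => labelProb (η x) true * S.indicator (1 : X × Bool → ℝ) (x, true) +
      labelProb (η x) false * S.indicator (1 : X × Bool → ℝ) (x, false) := by
    have h1 : Measurable (S.indicator (1 : X × Bool → ℝ)) := measurable_one.indicator hS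
    have h2 := fun b => hη.measurable_labelProb b
    have h3 : ∀ b : Bool, Measurable fun x => S.indicator (1 : X × Bool → ℝ) (x, b) := fun b =>
      h1.comp (by fun_prop)
    exact ((h2 true).mul (h3 true)).add ((h2 false).mul (h3 false))
  refine ⟨Integrable.of_bound hm.aestronglyMeasurable 2 (Eventually.of_forall fun x => ?_), ?_⟩
  · rw [Real.norm_eq_abs, abs_of_nonneg (hnn x)]
    have e := fun b => mul_le_one₀ (hη.labelProb_mem b x).2 (hi (x, b)).1 (hi (x, b)).2
    linarith [e true, e false]
  · rw [integral_eq_lintegral_of_nonneg_ae (Eventually.of_forall hnn) hm.aestronglyMeasurable,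
      Measure.real, ← lintegral_indicator_one hS, hη.lintegral_eq (measurable_one.indicator hS)]
    congr 1
    refine lintegral_congr fun x => ?_
    rw [ENNReal.ofReal_add (mul_nonneg (hη.labelProb_mem _ x).1 (hi _).1)
      (mul_nonneg (hη.labelProb_mem _ x).1 (hi _).1), ENNReal.ofReal_mul (hη.labelProb_mem _ x).1,
      ENNReal.ofReal_mul (hη.labelProb_mem _ x).1]
    congr 2
    · by_cases h : (x, true) ∈ S <;> simp [h]
    · by_cases h : (x, false) ∈ S <;> simp [h]

theorem chowExcess_le_integral (hη : IsCondProb D η) {γ : ℝ} {h : X → Option Bool}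
    (hh : @Measurable _ _ _ ⊤ h) {φ : X → ℝ} (hφ : Integrable φ D.fst)
    (hle : ∀ x, predictionCost γ (η x) (h x) - predictionCost γ (η x) (some (bayes η x)) ≤ φ x) :
    chowExcess D η γ h ≤ ∫ x, φ x ∂D.fst := by
  have hpre : ∀ T : Set (Option Bool), MeasurableSet (h ⁻¹' T) := fun T => hh trivial
  have hS2 : MeasurableSet {p : X × Bool | h p.1 = none} := measurable_fst (hpre {none})
  have hS1 : MeasurableSet {p : X × Bool | h p.1 ≠ some p.2 ∧ h p.1 ≠ none} := by
    have : {p : X × Bool | h p.1 ≠ some p.2 ∧ h p.1 ≠ none} =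
        (h ⁻¹' {some true}) ×ˢ {false} ∪ (h ⁻¹' {some false}) ×ˢ {true} := by
      ext ⟨x, y⟩
      rcases hx : h x with _ | c
      · simp [hx]
      · cases c <;> cases y <;> simp [hx]
    rw [this]
    exact ((hpre _).prod (MeasurableSet.singleton _)).union
      ((hpre _).prod (MeasurableSet.singleton _))
  have hb : Measurable (bayes η) := by
    have : MeasurableSet {x | 1 / 2 ≤ η x} := measurableSet_le measurable_const hη.1
    refine measurable_to_bool ?_
    convert this using 1
    ext x
    simp [bayes]
  have hS3 : MeasurableSet {p : X × Bool | bayes η p.1 ≠ p.2} :=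
    (measurableSet_eq_fun (hb.comp measurable_fst) measurable_snd).compl
  obtain ⟨i1, e1⟩ := hη.measureReal_eq hS1
  obtain ⟨i2, e2⟩ := hη.measureReal_eq hS2
  obtain ⟨i3, e3⟩ := hη.measureReal_eq hS3
  unfold chowExcess chowErr err
  have key : ∀ F₁ F₂ F₃ : X → ℝ, Integrable F₁ D.fst → Integrable F₂ D.fst →
      Integrable F₃ D.fst → (∀ x, F₁ x + (1 / 2 - γ) * F₂ x - F₃ x ≤ φ x) →
      ∫ x, F₁ x ∂D.fst + (1 / 2 - γ) * ∫ x, F₂ x ∂D.fst - ∫ x, F₃ x ∂D.fst ≤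
        ∫ x, φ x ∂D.fst := by
    intro F₁ F₂ F₃ h₁ h₂ h₃ h₄
    have h₂' := h₂.const_mul (1 / 2 - γ)
    have h₁₂ : Integrable (fun x => F₁ x + (1 / 2 - γ) * F₂ x) D.fst := h₁.add h₂'
    rw [← integral_const_mul, ← integral_add h₁ h₂', ← integral_sub h₁₂ h₃]
    exact integral_mono (h₁₂.sub h₃) hφ h₄
  rw [e1, e2, e3]
  refine key _ _ _ i1 i2 i3 fun x => ?_
  refine le_trans (le_of_eq ?_) (hle x)
  rcases hx : h x with _ | c
  · cases hbx : bayes η x <;> simp [hx, hbx, predictionCost, labelProb, Set.indicator]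
  · cases c <;> cases hbx : bayes η x <;>
      simp [hx, hbx, predictionCost, labelProb, Set.indicator]

end Chow

/-! ### Probability of the good event. -/

namespace Input

variable {X : Type*} [MeasurableSpace X] {I : Input X}

theorem measurable_queryInd (hrun : I.IsMeasurableRun) {m : ℕ} (h1 : 1 ≤ m) (hm : m ≤ I.M) :
    Measurable fun p : (ℕ → X × Bool) × X => I.queryInd m p.1 p.2 := by
  have h := (hrun m h1 hm).1
  exact Measurable.ite (h (MeasurableSet.singleton true)) measurable_const measurable_const

theorem log_add_one_le {t M : ℕ} (ht : t < tau (M - 1)) : Nat.log 2 t + 1 ≤ M := by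
  by_contra! h
  have := tau_mono (show M - 1 ≤ Nat.log 2 t by omega)
  have := tau_log_le t
  omega

theorem measurable_queried (hrun : I.IsMeasurableRun) {t : ℕ} (ht : t < tau (I.M - 1)) :
    Measurable (I.queried t) :=
  (measurable_queryInd hrun (Nat.le_add_left 1 _) (log_add_one_le ht)).comp
    (f := fun z : ℕ → X × Bool => (z, (z t).1)) (by fun_prop)

variable {D : Measure (X × Bool)} [IsProbabilityMeasure D] {η : X → ℝ}

theorem measure_noise_Ico_gt_le (hη : IsCondProb D η)
    (hF : ∀ f ∈ I.F, Measurable f ∧ ∀ x, f x ∈ Set.Icc (0 : ℝ) 1) (hsep : PointwiseSeparable I.F)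
    {d : ℕ} (hd : pdim I.F = d) {g : X → ℝ} (hg : g ∈ I.F) (hrun : I.IsMeasurableRun)
    {a b : ℕ} (hb : b ≤ tau (I.M - 1)) (hn : 0 < tau (I.M - 1)) (B : ℝ) :
    Measure.infinitePi (fun _ : ℕ => D)
      {z | ∃ f ∈ I.F, B < ∑ t ∈ Finset.Ico a b, noiseTerm η g f (I.queried t z) (z t)} ≤
      ENNReal.ofReal (Real.exp ((3 - B) / 2)) *
        ((tau (I.M - 1) * tau (I.M - 1) + 1) ^ d : ℕ) := by
  have h := measure_noise_gt_le hη hF hsep hd hg hn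
    -- Zero weights outside the window let one bound, over the full horizon, serve every window.
    (q := fun t z => if a ≤ t ∧ t < b then I.queried t z else 0) ?_ ?_ ?_ B
  · refine le_trans (measure_mono ?_) h
    rintro z ⟨f, hf, hz⟩
    refine ⟨f, hf, hz.trans_eq ?_⟩
    have h1 : ∀ t, noiseTerm η g f (if a ≤ t ∧ t < b then I.queried t z else 0) (z t) =
        if a ≤ t ∧ t < b then noiseTerm η g f (I.queried t z) (z t) else 0 := by
      intro t
      split_ifs <;> simp [noiseTerm]
    simp only [h1]
    rw [← Finset.sum_filter]
    refine Finset.sum_congr ?_ fun _ _ => rfl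
    ext t
    simp only [Finset.mem_Ico, Finset.mem_filter, Finset.mem_range]
    constructor
    · exact fun h => ⟨by omega, h⟩
    · exact fun h => h.2
  · intro t ht
    by_cases h : a ≤ t ∧ t < b
    · simpa [h] using measurable_queried hrun ht
    · simp [h]
  · intro t z
    split_ifs
    · exact I.queried_mem t z
    · simp
  · intro t _ s hs z c
    simp only [I.queried_update hs]

theorem measure_ghost_epoch_gt_le
    (hF : ∀ f ∈ I.F, Measurable f ∧ ∀ x, f x ∈ Set.Icc (0 : ℝ) 1) (hsep : PointwiseSeparable I.F)
    {d : ℕ} (hd : pdim I.F = d) {g : X → ℝ} (hg : g ∈ I.F) (hrun : I.IsMeasurableRun)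
    {m : ℕ} (hm : m + 2 ≤ I.M) (B : ℝ) :
    Measure.infinitePi (fun _ : ℕ => D)
      {z | ∃ f ∈ I.F, B < (tau (m + 1) - tau m : ℕ) *
          ∫ x, wsq (I.queryInd (m + 1) z) g f x ∂D.fst -
        2 * ∑ i ∈ Finset.range (tau (m + 1) - tau m),
          wsq (I.queryInd (m + 1) z) g f (z (tau m + i)).1} ≤
      ENNReal.ofReal (Real.exp ((6 - B) / 8)) *
        ((2 * tau (I.M - 1) * tau (I.M - 1) + 1) ^ d : ℕ) := by
  have hlt : tau m < tau (m + 1) := by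
    rw [tau_succ]
    by_cases h : m = 0
    · simp [tau, h]
    · simp only [tau, h, if_false]
      exact Nat.pow_lt_pow_right (by norm_num) (Nat.lt_succ_self m)
  have hle : tau (m + 1) ≤ tau (I.M - 1) := tau_mono (by omega)
  refine (measure_ghost_gt_le hF hsep hd hg (Nat.sub_pos_of_lt hlt)
    (measurable_queryInd hrun (Nat.le_add_left 1 m) (by omega)) (I.queryInd_mem (m + 1))
    (fun z z' h => I.queryInd_congr (by simpa using h)) B).trans ?_
  gcongr <;> omega

theorem measure_queried_gt_le (hrun : I.IsMeasurableRun) (B : ℝ) :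
    Measure.infinitePi (fun _ : ℕ => D)
      {z | B < ∑ t ∈ Finset.range (tau (I.M - 1)),
        (I.queried t z - 2 * ∫ x, I.queryInd (Nat.log 2 t + 1) z x ∂D.fst)} ≤
      ENNReal.ofReal (Real.exp (-B)) :=
  measure_count_gt_le (w := fun t z x => I.queryInd (Nat.log 2 t + 1) z x)
    (fun t ht => measurable_queryInd hrun (Nat.le_add_left 1 _) (log_add_one_le ht))
    (fun t z x => I.queryInd_mem _ z x)
    (fun t z z' h => I.queryInd_congr fun s hs => h s (by
      rw [Nat.add_sub_cancel] at hs
      exact hs.trans_le (tau_log_le t))) B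

/-- The deviations of the data sequence `z` are at most `B`: the noise in the loss differences, the
empirical squared differences to `g` in each epoch, and the number of queries. -/
structure SmallDeviations (I : Input X) (D : Measure (X × Bool)) (η g : X → ℝ) (B : ℝ)
    (z : ℕ → X × Bool) : Prop where
  noise_prefix : ∀ m, m + 1 ≤ I.M → ∀ f ∈ I.F,
    ∑ t ∈ Finset.Ico 0 (tau m), noiseTerm η g f (I.queried t z) (z t) ≤ B
  noise_epoch : ∀ m, m + 2 ≤ I.M → ∀ f ∈ I.F,
    ∑ t ∈ Finset.Ico (tau m) (tau (m + 1)), noiseTerm η g f (I.queried t z) (z t) ≤ B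
  ghost : ∀ m, m + 2 ≤ I.M → ∀ f ∈ I.F,
    (tau (m + 1) - tau m : ℕ) * ∫ x, wsq (I.queryInd (m + 1) z) g f x ∂D.fst -
      2 * ∑ i ∈ Finset.range (tau (m + 1) - tau m),
        wsq (I.queryInd (m + 1) z) g f (z (tau m + i)).1 ≤ B
  count : ∑ t ∈ Finset.range (tau (I.M - 1)),
    (I.queried t z - 2 * ∫ x, I.queryInd (Nat.log 2 t + 1) z x ∂D.fst) ≤ B

theorem measure_not_smallDeviations_le (hη : IsCondProb D η)
    (hF : ∀ f ∈ I.F, Measurable f ∧ ∀ x, f x ∈ Set.Icc (0 : ℝ) 1) (hsep : PointwiseSeparable I.F)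
    {d : ℕ} (hd : pdim I.F = d) {g : X → ℝ} (hg : g ∈ I.F) (hrun : I.IsMeasurableRun)
    (hM : 2 ≤ I.M) {B : ℝ} (hB : 2 ≤ B) :
    Measure.infinitePi (fun _ : ℕ => D) {z | ¬ I.SmallDeviations D η g B z} ≤
      (4 * I.M : ℕ) * (ENNReal.ofReal (Real.exp ((6 - B) / 8)) *
        ((2 * tau (I.M - 1) * tau (I.M - 1) + 1) ^ d : ℕ)) := by
  set q := ENNReal.ofReal (Real.exp ((6 - B) / 8)) *
    ((2 * tau (I.M - 1) * tau (I.M - 1) + 1) ^ d : ℕ) with hq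
  set P := Measure.infinitePi (fun _ : ℕ => D) with hP
  have hn : 0 < tau (I.M - 1) := by
    rw [show I.M - 1 = I.M - 2 + 1 by omega, tau_succ]
    positivity
  let N (a b : ℕ) : Set (ℕ → X × Bool) :=
    {z | ∃ f ∈ I.F, B < ∑ t ∈ Finset.Ico a b, noiseTerm η g f (I.queried t z) (z t)}
  let G (m : ℕ) : Set (ℕ → X × Bool) :=
    {z | ∃ f ∈ I.F, B < (tau (m + 1) - tau m : ℕ) *
          ∫ x, wsq (I.queryInd (m + 1) z) g f x ∂D.fst -
        2 * ∑ i ∈ Finset.range (tau (m + 1) - tau m),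
          wsq (I.queryInd (m + 1) z) g f (z (tau m + i)).1}
  let Q : Set (ℕ → X × Bool) := {z | B < ∑ t ∈ Finset.range (tau (I.M - 1)),
        (I.queried t z - 2 * ∫ x, I.queryInd (Nat.log 2 t + 1) z x ∂D.fst)}
  have hN : ∀ a b, b ≤ tau (I.M - 1) → P (N a b) ≤ q := by
    intro a b hb
    refine (measure_noise_Ico_gt_le hη hF hsep hd hg hrun hb hn B).trans ?_
    rw [hq]
    gcongr ENNReal.ofReal (Real.exp ?_) * ((?_ ^ _ : ℕ) : ℝ≥0∞)
    · linarith
    · nlinarith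
  have hG : ∀ m, m + 2 ≤ I.M → P (G m) ≤ q := fun m hm =>
    measure_ghost_epoch_gt_le hF hsep hd hg hrun hm B
  have hQ : P Q ≤ q := by
    refine (measure_queried_gt_le hrun B).trans ?_
    rw [hq]
    refine le_trans ?_ (le_mul_of_one_le_right' (by exact_mod_cast Nat.one_le_pow _ _ (by omega)))
    gcongr
    linarith
  have hsub : {z | ¬ I.SmallDeviations D η g B z} ⊆
      (⋃ m ∈ Finset.range I.M, N 0 (tau m)) ∪
      (⋃ m ∈ Finset.range (I.M - 1), N (tau m) (tau (m + 1))) ∪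
      (⋃ m ∈ Finset.range (I.M - 1), G m) ∪ Q := by
    intro z hz
    by_contra hc
    simp only [Set.mem_union, Set.mem_iUnion, not_or, not_exists, Finset.mem_range] at hc
    obtain ⟨⟨⟨c1, c2⟩, c3⟩, c4⟩ := hc
    refine hz ⟨fun m hm f hf => ?_, fun m hm f hf => ?_, fun m hm f hf => ?_, not_lt.1 c4⟩
    · exact not_lt.1 fun h => c1 m (by omega) ⟨f, hf, h⟩
    · exact not_lt.1 fun h => c2 m (by omega) ⟨f, hf, h⟩
    · exact not_lt.1 fun h => c3 m (by omega) ⟨f, hf, h⟩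
  have hsum : ∀ (k : ℕ) (A : ℕ → Set (ℕ → X × Bool)), (∀ m < k, P (A m) ≤ q) →
      P (⋃ m ∈ Finset.range k, A m) ≤ k * q := by
    intro k A hA
    refine (measure_biUnion_finset_le _ _).trans ((Finset.sum_le_sum fun m hm =>
      hA m (Finset.mem_range.1 hm)).trans ?_)
    simp
  refine (measure_mono hsub).trans ?_
  refine (measure_union_le _ _).trans ((add_le_add ((measure_union_le _ _).trans
    (add_le_add ((measure_union_le _ _).trans (add_le_add
      (hsum I.M _ fun m hm => hN _ _ (tau_mono (by omega)))
      (hsum (I.M - 1) _ fun m hm => hN _ _ (tau_mono (by omega)))))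
      (hsum (I.M - 1) _ fun m hm => hG m (by omega)))) hQ).trans ?_)
  have hle : ((I.M : ℝ≥0∞) + (I.M - 1 : ℕ) + (I.M - 1 : ℕ) + (1 : ℕ)) ≤ (4 * I.M : ℕ) := by
    rw [← Nat.cast_add, ← Nat.cast_add, ← Nat.cast_add]
    exact_mod_cast (by omega)
  calc _ = ((I.M : ℝ≥0∞) + (I.M - 1 : ℕ) + (I.M - 1 : ℕ) + (1 : ℕ)) * q := by
        push_cast
        ring
    _ ≤ _ := by gcongr

end Input

/-! ### Deterministic consequences on the good event. -/

namespace Input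

variable {X : Type*} [MeasurableSpace X] {I : Input X} {D : Measure (X × Bool)} {η g : X → ℝ}
  {B κ : ℝ} {z : ℕ → X × Bool}

theorem SmallDeviations.controlled (h : I.SmallDeviations D η g B z)
    (hκ : ∀ x, |g x - η x| ≤ κ) (hB : 4 * κ ^ 2 * tau (I.M - 1) + B ≤ I.Cδ) :
    I.Controlled g z := by
  intro f hf a b hab
  have hb : b ≤ tau (I.M - 1) := by
    rcases hab with ⟨m, hm, -, rfl⟩ | ⟨m, hm, -, rfl⟩ <;> exact tau_mono (by omega)
  have hnoise : ∑ t ∈ Finset.Ico a b, noiseTerm η g f (I.queried t z) (z t) ≤ B := by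
    rcases hab with ⟨m, hm, rfl, rfl⟩ | ⟨m, hm, rfl, rfl⟩
    · exact h.noise_prefix m hm f hf
    · exact h.noise_epoch m hm f hf
  have h1 := I.sq_sum_le_lossDiff (f := f) hκ (a := a) (b := b) z
  have h2 : 4 * κ ^ 2 * ((b - a : ℕ) : ℝ) ≤ 4 * κ ^ 2 * tau (I.M - 1) := by
    gcongr
    omega
  linarith

theorem measurable_queryInd_right (hrun : I.IsMeasurableRun) {m : ℕ} (h1 : 1 ≤ m) (hm : m ≤ I.M)
    (z : ℕ → X × Bool) : Measurable (I.queryInd m z) :=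
  (measurable_queryInd hrun h1 hm).comp (f := fun x => (z, x)) (by fun_prop)

variable [IsProbabilityMeasure D]

theorem integrable_wsq_queryInd (hF : ∀ f ∈ I.F, Measurable f ∧ ∀ x, f x ∈ Set.Icc (0 : ℝ) 1)
    (hg : g ∈ I.F) (hrun : I.IsMeasurableRun) {m : ℕ} (h1 : 1 ≤ m) (hm : m ≤ I.M) {f : X → ℝ}
    (hf : f ∈ I.F) : Integrable (wsq (I.queryInd m z) g f) D.fst := by
  have hw := measurable_queryInd_right hrun h1 hm z
  have := (hF g hg).1
  have := (hF f hf).1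
  refine Integrable.of_bound (Measurable.aestronglyMeasurable (by unfold wsq; fun_prop)) 1
    (Eventually.of_forall fun x => ?_)
  have := wsq_mem (I.queryInd_mem m z x) ((hF g hg).2 x) ((hF f hf).2 x)
  rw [Real.norm_eq_abs, abs_of_nonneg this.1]
  exact this.2

theorem integrable_queryInd (hrun : I.IsMeasurableRun) {m : ℕ} (h1 : 1 ≤ m) (hm : m ≤ I.M)
    (z : ℕ → X × Bool) : Integrable (I.queryInd m z) D.fst :=
  Integrable.of_bound (measurable_queryInd_right hrun h1 hm z).aestronglyMeasurable 1
    (Eventually.of_forall fun x => by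
      have := I.queryInd_mem m z x
      rw [Real.norm_eq_abs, abs_of_nonneg this.1]
      exact this.2)

theorem tau_succ_le_two_mul (m : ℕ) : tau (m + 1) ≤ 2 * (tau (m + 1) - tau m) := by
  rw [tau_succ]
  by_cases h : m = 0
  · simp [tau, h]
  · simp only [tau, h, if_false]
    rw [pow_succ]
    omega

/-- In every epoch the active functions are close to `g` in mean square on the query region. -/
theorem SmallDeviations.integral_wsq_le (h : I.SmallDeviations D η g B z)
    (hF : ∀ f ∈ I.F, Measurable f ∧ ∀ x, f x ∈ Set.Icc (0 : ℝ) 1)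
    (hor : IsRegressionOracle I.F I.oracle) (hg : g ∈ I.F) (hrun : I.IsMeasurableRun)
    (hz : I.Controlled g z) (hC : 0 ≤ I.Cδ) (hBC : B ≤ I.Cδ) {m : ℕ} (hm : m + 2 ≤ I.M)
    {f : X → ℝ} (hf : f ∈ I.epochSet (m + 2) z) :
    ∫ x, wsq (I.queryInd (m + 2) z) g f x ∂D.fst ≤ 26 * I.β (m + 2) / tau (m + 1) := by
  have hF' : ∀ f ∈ I.F, ∀ x, f x ∈ Set.Icc (0 : ℝ) 1 := fun f hf => (hF f hf).2
  have hfF : f ∈ I.F := hf.1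
  have h1 := sum_sq_le_of_mem_epochSet hor hC hg hz hm hf
  have h2 := h.ghost m hm f hfF
  have h3 := I.two_Cδ_le_β hC hm
  -- The available data were filtered by the query function of epoch `m + 1`; nestedness transfers
  -- the estimate to the smaller region of epoch `m + 2`.
  have h4 : ∫ x, wsq (I.queryInd (m + 2) z) g f x ∂D.fst ≤
      ∫ x, wsq (I.queryInd (m + 1) z) g f x ∂D.fst := by
    refine integral_mono (integrable_wsq_queryInd hF hg hrun (by omega) hm hfF)
      (integrable_wsq_queryInd hF hg hrun (by omega) (by omega) hfF) fun x => ?_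
    refine mul_le_mul_of_nonneg_right ?_ (sq_nonneg _)
    by_cases hq : I.epochQuery (m + 2) z x = true
    · have := epochQuery_anti hF' hor hC hg hz (m := m + 1) (by omega) hm hq
      simp [queryInd, hq, this]
    · simp only [queryInd, hq]
      exact (I.queryInd_mem (m + 1) z x).1
  have h0 : 0 ≤ ∫ x, wsq (I.queryInd (m + 1) z) g f x ∂D.fst := integral_nonneg fun x =>
    (wsq_mem (I.queryInd_mem _ z x) ((hF g hg).2 x) ((hF f hfF).2 x)).1
  have h5 : (0 : ℝ) < tau (m + 1) := by rw [tau_succ]; positivity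
  have h6 : (tau (m + 1) : ℝ) ≤ 2 * ((tau (m + 1) - tau m : ℕ) : ℝ) := by
    exact_mod_cast tau_succ_le_two_mul m
  rw [le_div_iff₀ h5]
  have h7 : (∫ x, wsq (I.queryInd (m + 2) z) g f x ∂D.fst) * tau (m + 1) ≤
      (∫ x, wsq (I.queryInd (m + 1) z) g f x ∂D.fst) * (2 * ((tau (m + 1) - tau m : ℕ) : ℝ)) :=
    mul_le_mul h4 h6 h5.le h0
  -- The bound obtained is `2 (2 * 6 β + B)`, and `2 B ≤ 2 C_δ ≤ β`.
  linarith

/-- The probability of the query region is controlled by the disagreement coefficient. -/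
theorem SmallDeviations.integral_queryInd_le (h : I.SmallDeviations D η g B z)
    (hF : ∀ f ∈ I.F, Measurable f ∧ ∀ x, f x ∈ Set.Icc (0 : ℝ) 1)
    (hor : IsRegressionOracle I.F I.oracle) (hg : g ∈ I.F) (hrun : I.IsMeasurableRun)
    (hz : I.Controlled g z) (hC : 0 < I.Cδ) (hBC : B ≤ I.Cδ) (hγ : 0 < I.γ) {m : ℕ}
    (hm : m + 2 ≤ I.M) (hθ : valDisagreementSup I.F g (I.γ / 2) ≠ ⊤) :
    ∫ x, I.queryInd (m + 2) z x ∂D.fst ≤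
      26 * I.β (m + 2) / tau (m + 1) / (I.γ / 2) ^ 2 *
        (valDisagreementSup I.F g (I.γ / 2)).toReal := by
  have hF' : ∀ f ∈ I.F, ∀ x, f x ∈ Set.Icc (0 : ℝ) 1 := fun f hf => (hF f hf).2
  have hgm := mem_epochSet hor hC.le hg hz (m := m + 2) (by omega) hm
  have hβ := I.two_Cδ_le_β hC.le hm
  have h5 : (0 : ℝ) < tau (m + 1) := by rw [tau_succ]; positivity
  have hs : 0 < 26 * I.β (m + 2) / tau (m + 1) := div_pos (by linarith) h5
  set A : Set X := {x | I.epochQuery (m + 2) z x = true} with hA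
  have hAm : MeasurableSet A :=
    ((hrun (m + 2) (by omega) hm).1.comp (f := fun x => (z, x)) (by fun_prop))
      (MeasurableSet.singleton true)
  have hind : ∀ φ : X → ℝ, (fun x => I.queryInd (m + 2) z x * φ x) = A.indicator φ := by
    intro φ
    funext x
    by_cases hx : I.epochQuery (m + 2) z x = true
    · simp [queryInd, hA, hx]
    · simp [queryInd, hA, hx]
  have hle := measure_le_valDisagreementSup D.fst (I.activeSet_subset _ _) (g := g)
    (V := I.epochSet (m + 2) z) (A := A) hs (half_pos hγ) ?_ ?_
  · have hreal : ∫ x, I.queryInd (m + 2) z x ∂D.fst = D.fst.real A := by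
      have := hind 1
      simp only [Pi.one_apply, mul_one] at this
      rw [show (fun x => I.queryInd (m + 2) z x) = A.indicator 1 from this,
        integral_indicator_one hAm]
    rw [hreal, Measure.real]
    refine (ENNReal.toReal_mono (ENNReal.mul_ne_top ENNReal.ofReal_ne_top hθ) hle).trans ?_
    rw [ENNReal.toReal_mul, ENNReal.toReal_ofReal (by positivity)]
  · intro f hf
    rw [← integral_indicator hAm, ← hind]
    exact h.integral_wsq_le hF hor hg hrun hz hC.le hBC hm hf
  · exact fun x hx => I.exists_gap_of_query hF' hgm hx

/-- The length of an epoch cancels the `τ` in the denominator of the region's probability, so every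
epoch contributes at most the same amount `R`. -/
theorem SmallDeviations.labelCount_le (h : I.SmallDeviations D η g B z)
    (hF : ∀ f ∈ I.F, Measurable f ∧ ∀ x, f x ∈ Set.Icc (0 : ℝ) 1)
    (hor : IsRegressionOracle I.F I.oracle) (hg : g ∈ I.F) (hrun : I.IsMeasurableRun)
    (hz : I.Controlled g z) (hC : 1 ≤ I.Cδ) (hBC : B ≤ I.Cδ) (hγ : 0 < I.γ) (hγ1 : I.γ < 1 / 2)
    (hM : 1 ≤ I.M) (hθ : valDisagreementSup I.F g (I.γ / 2) ≠ ⊤) :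
    (I.labelCount z : ℝ) ≤ 2 * (I.M * (104 * I.β 1 / I.γ ^ 2 *
      (valDisagreementSup I.F g (I.γ / 2)).toReal)) + I.Cδ := by
  set θ := (valDisagreementSup I.F g (I.γ / 2)).toReal with hθdef
  have hθ1 : 1 ≤ θ := by
    have := ENNReal.toReal_mono hθ (one_le_valDisagreementSup I.F g (I.γ / 2))
    simpa using this
  have hβ1 := I.two_Cδ_le_β (by linarith) hM
  have hγ2 : 0 < I.γ ^ 2 := by positivity
  set R := 104 * I.β 1 / I.γ ^ 2 * θ with hR
  have hR0 : 104 * 2 ≤ R := by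
    have h1 : 104 * 2 ≤ 104 * I.β 1 / I.γ ^ 2 := by
      rw [le_div_iff₀ hγ2]
      nlinarith
    nlinarith
  set p : ℕ → ℝ := fun t => ∫ x, I.queryInd (Nat.log 2 t + 1) z x ∂D.fst with hp
  have hepoch : ∀ m, m + 1 ≤ I.M - 1 → ∑ t ∈ Finset.Ico (tau m) (tau (m + 1)), p t ≤ R := by
    intro m hm
    have h1 : ∀ t ∈ Finset.Ico (tau m) (tau (m + 1)),
        p t = ∫ x, I.queryInd (m + 1) z x ∂D.fst := by
      intro t ht
      rw [Finset.mem_Ico] at ht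
      simp only [hp, log_eq_of_tau_le ht.1 ht.2]
    rw [Finset.sum_congr rfl h1, Finset.sum_const, Nat.card_Ico, nsmul_eq_mul]
    rcases m with _ | m
    -- No data precede epoch 1; its two points are counted trivially, and `R` exceeds 2.
    · have h2 : ∫ x, I.queryInd (0 + 1) z x ∂D.fst ≤ ∫ _, (1 : ℝ) ∂D.fst :=
        integral_mono (integrable_queryInd hrun (by omega) (by omega) z) (integrable_const 1)
          fun x => (I.queryInd_mem _ z x).2
      rw [integral_const, probReal_univ, one_smul] at h2
      simp only [tau]
      norm_num
      linarith
    · have h2 := h.integral_queryInd_le hF hor hg hrun hz (by linarith) hBC hγ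
        (m := m) (by omega) hθ
      rw [← hθdef] at h2
      have h3 : tau (m + 1 + 1) - tau (m + 1) = tau (m + 1) := by
        rw [tau_succ, tau_succ, pow_succ 2 (m + 1)]
        omega
      have h5 : (0 : ℝ) < tau (m + 1) := by rw [tau_succ]; positivity
      rw [h3]
      calc _ ≤ (tau (m + 1) : ℝ) * (26 * I.β (m + 2) / tau (m + 1) / (I.γ / 2) ^ 2 * θ) :=
            mul_le_mul_of_nonneg_left h2 h5.le
        _ = 104 * I.β (m + 2) / I.γ ^ 2 * θ := by
            field_simp
            ring
        _ ≤ R := by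
            rw [hR]
            gcongr
            exact I.β_le_β_one (by linarith) (by omega)
  have hprefix : ∀ j, j ≤ I.M - 1 → ∑ t ∈ Finset.Ico 0 (tau j), p t ≤ j * R := by
    intro j
    induction j with
    | zero => simp [tau]
    | succ j ih =>
      intro hj
      rw [← Finset.sum_Ico_consecutive _ (Nat.zero_le _) (tau_succ_le j)]
      push_cast
      linarith [ih (by omega), hepoch j hj]
  have h1 := h.count
  rw [Finset.sum_sub_distrib, ← Finset.mul_sum, Finset.range_eq_Ico, ← I.length_history] at h1
  have h2 := hprefix (I.M - 1) le_rfl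
  have h3 : ((I.M - 1 : ℕ) : ℝ) * R ≤ I.M * R := by
    gcongr
    omega
  unfold labelCount
  linarith

theorem SmallDeviations.chowExcess_le (h : I.SmallDeviations D η g B z) (hη : IsCondProb D η)
    (hF : ∀ f ∈ I.F, Measurable f ∧ ∀ x, f x ∈ Set.Icc (0 : ℝ) 1)
    (hor : IsRegressionOracle I.F I.oracle) (hg : g ∈ I.F) (hrun : I.IsMeasurableRun)
    (hκ : ∀ x, |g x - η x| ≤ κ)
    (hz : I.Controlled g z) (hC : 0 < I.Cδ) (hBC : B ≤ I.Cδ) (hγ : 0 < I.γ)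
    (hM : 2 ≤ I.M) (hθ : valDisagreementSup I.F g (I.γ / 2) ≠ ⊤) :
    chowExcess D η I.γ (I.output z) ≤ 2 * κ + 104 * I.β I.M / (tau (I.M - 1) * I.γ) *
      (valDisagreementSup I.F g (I.γ / 2)).toReal := by
  set θ := (valDisagreementSup I.F g (I.γ / 2)).toReal with hθdef
  have hθ1 : 1 ≤ θ := by
    have := ENNReal.toReal_mono hθ (one_le_valDisagreementSup I.F g (I.γ / 2))
    simpa using this
  have hF' : ∀ f ∈ I.F, ∀ x, f x ∈ Set.Icc (0 : ℝ) 1 := fun f hf => (hF f hf).2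
  obtain ⟨m, hm⟩ := Nat.exists_eq_add_of_le' hM
  have hgm := mem_epochSet hor hC.le hg hz (m := I.M) (by omega) le_rfl
  have hβ := I.two_Cδ_le_β hC.le (le_refl I.M)
  set f := I.oracle (I.history (I.M - 1) z) with hf
  have hfm : f ∈ I.epochSet I.M z := ⟨(hor _).1, by linarith⟩
  have hs := h.integral_wsq_le hF hor hg hrun hz hC.le hBC (m := m) hm.ge (hm ▸ hfm)
  have hp := h.integral_queryInd_le hF hor hg hrun hz hC hBC hγ (m := m) hm.ge hθ
  rw [← hθdef] at hp
  rw [← hm] at hs hp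
  have hm1 : m + 1 = I.M - 1 := by omega
  rw [hm1] at hs hp
  have hn : (0 : ℝ) < tau (I.M - 1) := by rw [← hm1, tau_succ]; positivity
  set γ₀ := I.γ / 2 with hγ₀
  have hγ₀0 : 0 < γ₀ := half_pos hγ
  set w := I.queryInd I.M z with hw
  have hiw : Integrable w D.fst := integrable_queryInd hrun (by omega) le_rfl z
  have hiq : Integrable (wsq w g f) D.fst :=
    integrable_wsq_queryInd hF hg hrun (by omega) le_rfl (hor _).1
  have hφ1 : Integrable (fun x => γ₀ * w x) D.fst := hiw.const_mul γ₀
  have hφ2 : Integrable (fun x => γ₀⁻¹ * wsq w g f x) D.fst := hiq.const_mul γ₀⁻¹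
  have hφ12 : Integrable (fun x => γ₀ * w x + γ₀⁻¹ * wsq w g f x) D.fst := hφ1.add hφ2
  have hle := chowExcess_le_integral (γ := I.γ) (h := I.output z) hη ?_
    (φ := fun x => 2 * κ + (γ₀ * w x + γ₀⁻¹ * wsq w g f x)) ((integrable_const _).add hφ12) ?_
  · rw [integral_add (integrable_const _) hφ12, integral_add hφ1 hφ2,
      integral_const_mul γ₀, integral_const_mul γ₀⁻¹, integral_const, probReal_univ, one_smul] at hle
    set s := 26 * I.β I.M / tau (I.M - 1) with hsdef
    have hs0 : 0 ≤ s := div_nonneg (by linarith) hn.le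
    have e1 : γ₀ * ∫ x, w x ∂D.fst ≤ γ₀⁻¹ * s * θ := by
      calc _ ≤ γ₀ * (s / γ₀ ^ 2 * θ) := mul_le_mul_of_nonneg_left hp hγ₀0.le
        _ = _ := by field_simp
    have e2 : γ₀⁻¹ * ∫ x, wsq w g f x ∂D.fst ≤ γ₀⁻¹ * s * θ :=
      (mul_le_mul_of_nonneg_left hs (by positivity)).trans
        (le_mul_of_one_le_right (by positivity) hθ1)
    have e3 : γ₀⁻¹ * s * θ + γ₀⁻¹ * s * θ = 104 * I.β I.M / (tau (I.M - 1) * I.γ) * θ := by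
      rw [hsdef, hγ₀]
      field_simp
      ring
    linarith
  · let _ : MeasurableSpace (Option Bool) := ⊤
    exact (hrun I.M (by omega) le_rfl).2.comp (f := fun x => (z, x)) (by fun_prop)
  · intro x
    refine (predictionCost_classifier_le hF' hfm hgm hκ hγ x).trans ?_
    have hw' : (if I.query (I.history (I.M - 1) z) (I.β I.M) x then (1 : ℝ) else 0) = w x := rfl
    rw [hw', ← hf]
    have hw0 : 0 ≤ w x := (I.queryInd_mem _ z x).1
    -- The weight `γ / 2` balances the probability of the query region, of order `s θ / γ²`, against
    -- the mean square, at most `s`.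
    have h1 : 2 * |f x - g x| ≤ γ₀ + γ₀⁻¹ * (f x - g x) ^ 2 := by
      have e : γ₀⁻¹ * (|f x - g x| - γ₀) ^ 2 =
          γ₀ + γ₀⁻¹ * (f x - g x) ^ 2 - 2 * |f x - g x| := by
        rw [← sq_abs (f x - g x)]
        field_simp
        ring
      have : 0 ≤ γ₀⁻¹ * (|f x - g x| - γ₀) ^ 2 := by positivity
      linarith
    have h2 := mul_le_mul_of_nonneg_left h1 hw0
    unfold wsq
    linarith

end Input

/-! ### Numerical consequences of the choice of parameters. -/

namespace Input

variable {X : Type*} {I : Input X}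

/-- The parameters are in the range required of the input of the algorithm. -/
structure Admissible (I : Input X) : Prop where
  one_le_d : 1 ≤ I.d
  ε_pos : 0 < I.ε
  ε_lt : I.ε < I.γ
  γ_lt : I.γ < 1 / 2
  δ_pos : 0 < I.δ
  δ_lt : I.δ < 1

namespace Admissible

theorem γ_pos (h : I.Admissible) : 0 < I.γ := h.ε_pos.trans h.ε_lt

theorem four_lt_T (h : I.Admissible) : 4 < I.T := by
  have h1 := h.ε_pos
  have h2 := h.γ_pos
  have h3 := h.ε_lt
  have h4 := h.γ_lt
  have h5 := h.one_le_d
  unfold T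
  rw [lt_div_iff₀ (by positivity)]
  nlinarith

theorem one_le_log_T (h : I.Admissible) : 1 ≤ Real.log I.T := by
  have h4 := h.four_lt_T
  rw [Real.le_log_iff_exp_le (by linarith)]
  linarith [Real.exp_one_lt_d9]

theorem log_T_div_δ (h : I.Admissible) :
    Real.log (I.T / I.δ) = Real.log I.T - Real.log I.δ :=
  Real.log_div (by linarith [h.four_lt_T]) h.δ_pos.ne'

theorem log_T_le (h : I.Admissible) : Real.log I.T ≤ Real.log (I.T / I.δ) := by
  rw [h.log_T_div_δ]
  linarith [Real.log_neg h.δ_pos h.δ_lt]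

theorem one_le_log (h : I.Admissible) : 1 ≤ Real.log (I.T / I.δ) := h.one_le_log_T.trans h.log_T_le

theorem M_lt (h : I.Admissible) : (I.M : ℝ) < Real.logb 2 I.T + 1 :=
  Nat.ceil_lt_add_one (Real.logb_nonneg (by norm_num) (by linarith [h.four_lt_T]))

theorem two_le_M (h : I.Admissible) : 2 ≤ I.M := by
  refine (Nat.lt_ceil.2 ?_).le
  have h4 := h.four_lt_T
  rw [Real.lt_logb_iff_rpow_lt (by norm_num) (by linarith)]
  norm_num
  exact h4

theorem M_le_log (h : I.Admissible) : (I.M : ℝ) ≤ 3 * Real.log I.T := by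
  have h1 := h.M_lt
  have h2 := h.one_le_log_T
  have h3 : Real.logb 2 I.T ≤ 2 * Real.log I.T := by
    unfold Real.logb
    rw [div_le_iff₀ (Real.log_pos (by norm_num))]
    nlinarith [Real.log_two_gt_d9]
  linarith

theorem tau_eq (h : I.Admissible) : tau (I.M - 1) = 2 ^ (I.M - 1) := by
  have := h.two_le_M
  rw [tau, if_neg (by omega)]

theorem tau_le_T (h : I.Admissible) : (tau (I.M - 1) : ℝ) ≤ I.T := by
  have h1 := h.M_lt
  have h4 := h.four_lt_T
  have h2 := h.two_le_M
  have h3 : ((I.M - 1 : ℕ) : ℝ) < Real.logb 2 I.T := by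
    rw [Nat.cast_sub (by omega)]
    push_cast
    linarith
  rw [Real.lt_logb_iff_rpow_lt (by norm_num) (by linarith), Real.rpow_natCast] at h3
  rw [h.tau_eq]
  push_cast
  exact h3.le

theorem T_le_two_mul_tau (h : I.Admissible) : I.T ≤ 2 * tau (I.M - 1) := by
  have h4 := h.four_lt_T
  have h2 := h.two_le_M
  have h3 : Real.logb 2 I.T ≤ (I.M : ℝ) := Nat.le_ceil _
  rw [Real.logb_le_iff_le_rpow (by norm_num) (by linarith), Real.rpow_natCast] at h3
  rw [h.tau_eq]
  push_cast
  rw [← pow_succ', show I.M - 1 + 1 = I.M by omega]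
  exact h3

theorem M_le_T (h : I.Admissible) : (I.M : ℝ) ≤ I.T := by
  refine le_trans ?_ h.tau_le_T
  have h2 := h.two_le_M
  rw [h.tau_eq]
  have : I.M - 1 < 2 ^ (I.M - 1) := Nat.lt_two_pow_self
  exact_mod_cast (by omega : I.M ≤ 2 ^ (I.M - 1))

/-- The horizon is short enough for the misspecification to be absorbed in `C_δ`: `ε² T = d ε / γ ≤
d`. -/
theorem ε_sq_mul_tau_le (h : I.Admissible) :
    I.ε ^ 2 * tau (I.M - 1) ≤ I.d * Real.log (I.T / I.δ) := by
  have h1 := h.ε_pos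
  have h2 := h.γ_pos
  have h3 := h.one_le_d
  calc I.ε ^ 2 * tau (I.M - 1) ≤ I.ε ^ 2 * I.T := by gcongr; exact h.tau_le_T
    _ = I.d * (I.ε / I.γ) := by
        unfold T
        field_simp
    _ ≤ I.d * 1 := by
        gcongr
        rw [div_le_one h2]
        exact h.ε_lt.le
    _ ≤ I.d * Real.log (I.T / I.δ) := by
        gcongr
        exact h.one_le_log

theorem one_le_d_mul_log (h : I.Admissible) : 1 ≤ I.d * Real.log (I.T / I.δ) :=
  one_le_mul_of_one_le_of_one_le h.one_le_d h.one_le_log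

theorem threshold_le (h : I.Admissible) :
    2 * I.ε ^ 2 * tau (I.M - 1) + 2 * I.Cδ ≤ 2 * (1 + I.c) * (I.d * Real.log (I.T / I.δ)) := by
  unfold Cδ
  linarith [h.ε_sq_mul_tau_le]

theorem β_one_le (h : I.Admissible) :
    I.β 1 ≤ I.M * (2 * (1 + I.c) * (I.d * Real.log (I.T / I.δ))) := by
  have := mul_le_mul_of_nonneg_left h.threshold_le (Nat.cast_nonneg (α := ℝ) I.M)
  unfold β
  push_cast
  linarith

theorem β_M_le (h : I.Admissible) : I.β I.M ≤ 2 * (1 + I.c) * (I.d * Real.log (I.T / I.δ)) := by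
  have := h.threshold_le
  unfold β
  linarith

/-- The number of events and the net size are at most `2 T²` and `T^(3d)`; the exponent `-B / 8`
beats both and leaves `δ`. -/
theorem failure_le (h : I.Admissible) {d : ℕ} (hd : (d : ℝ) = I.d) {B : ℝ}
    (hB : 54 * (I.d * Real.log (I.T / I.δ)) ≤ B) :
    ((4 * I.M : ℕ) : ℝ≥0∞) * (ENNReal.ofReal (Real.exp ((6 - B) / 8)) *
        ((2 * tau (I.M - 1) * tau (I.M - 1) + 1) ^ d : ℕ)) ≤ ENNReal.ofReal (2 * I.δ) := by
  have hT := h.four_lt_T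
  have hT0 : 0 < I.T := by linarith
  have hn := h.tau_le_T
  set l := Real.log I.T with hl
  set L := Real.log (I.T / I.δ) with hL
  have hl1 : 1 ≤ l := h.one_le_log_T
  have hlL : l ≤ L := h.log_T_le
  have hδ : Real.log I.δ = l - L := by rw [hL, h.log_T_div_δ]; ring
  have hexpl : Real.exp l = I.T := Real.exp_log hT0
  have e1 : ((4 * I.M : ℕ) : ℝ) ≤ 2 * Real.exp (2 * l) := by
    rw [two_mul l, Real.exp_add, hexpl]
    push_cast
    nlinarith [h.M_le_T]
  have e2 : (((2 * tau (I.M - 1) * tau (I.M - 1) + 1) ^ d : ℕ) : ℝ) ≤ Real.exp (3 * l * I.d) := by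
    rw [← hd, mul_comm (3 * l), Real.exp_nat_mul, show 3 * l = l + l + l by ring, Real.exp_add,
      Real.exp_add, hexpl]
    push_cast
    gcongr
    have : (tau (I.M - 1) : ℝ) * tau (I.M - 1) ≤ I.T * I.T := by gcongr
    nlinarith
  rw [← ENNReal.ofReal_natCast, ← ENNReal.ofReal_natCast ((_ : ℕ) ^ d),
    ← ENNReal.ofReal_mul (Real.exp_pos _).le, ← ENNReal.ofReal_mul (Nat.cast_nonneg _)]
  refine ENNReal.ofReal_le_ofReal ?_
  calc _ ≤ 2 * Real.exp (2 * l) * (Real.exp ((6 - B) / 8) * Real.exp (3 * l * I.d)) := by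
        gcongr
    _ = 2 * Real.exp (2 * l + ((6 - B) / 8 + 3 * l * I.d)) := by
        rw [Real.exp_add, Real.exp_add]
        ring
    _ ≤ 2 * Real.exp (Real.log I.δ) := by
        gcongr
        rw [hδ]
        have h1 : L ≤ I.d * L := le_mul_of_one_le_left (by linarith) h.one_le_d
        have h2 : l * I.d ≤ I.d * L := by
          rw [mul_comm]
          exact mul_le_mul_of_nonneg_left hlL (by linarith [h.one_le_d])
        linarith
    _ = 2 * I.δ := by rw [Real.exp_log h.δ_pos]

end Admissible

variable [MeasurableSpace X] {D : Measure (X × Bool)} [IsProbabilityMeasure D] {η g : X → ℝ}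
  {κ B : ℝ} {z : ℕ → X × Bool}

theorem SmallDeviations.bounds (h : I.SmallDeviations D η g B z) (hI : I.Admissible)
    (hη : IsCondProb D η) (hF : ∀ f ∈ I.F, Measurable f ∧ ∀ x, f x ∈ Set.Icc (0 : ℝ) 1)
    (hor : IsRegressionOracle I.F I.oracle) (hg : g ∈ I.F) (hrun : I.IsMeasurableRun)
    (hκ : ∀ x, |g x - η x| ≤ κ) (hκ0 : 0 ≤ κ) (hκε : κ ≤ I.ε) (hc : 5 ≤ I.c)
    (hB : B = (I.c - 4) * (I.d * Real.log (I.T / I.δ)))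
    (hθ : valDisagreementSup I.F g (I.γ / 2) ≠ ⊤) :
    chowExcess D η I.γ (I.output z) ≤
        4000 * (1 + I.c) * (I.ε * Real.log (I.T / I.δ)) *
          (valDisagreementSup I.F g (I.γ / 2)).toReal ∧
      (I.labelCount z : ℝ) ≤
        4000 * (1 + I.c) * (I.d / I.γ ^ 2 * Real.log I.T ^ 2 * Real.log (I.T / I.δ)) *
          (valDisagreementSup I.F g (I.γ / 2)).toReal := by
  set θ := (valDisagreementSup I.F g (I.γ / 2)).toReal with hθdef
  have hθ1 : 1 ≤ θ := by
    have := ENNReal.toReal_mono hθ (one_le_valDisagreementSup I.F g (I.γ / 2))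
    simpa using this
  have hdL := hI.one_le_d_mul_log
  have hL := hI.one_le_log
  have hl := hI.one_le_log_T
  have hd := hI.one_le_d
  have hεp := hI.ε_pos
  have hγp := hI.γ_pos
  have hC : I.Cδ = I.c * (I.d * Real.log (I.T / I.δ)) := rfl
  have hC1 : 1 ≤ I.Cδ := by rw [hC]; nlinarith
  -- The 4 subtracted from `c` in `B` makes room for the misspecification term.
  have hBC : 4 * κ ^ 2 * tau (I.M - 1) + B ≤ I.Cδ := by
    have h1 : κ ^ 2 * tau (I.M - 1) ≤ I.ε ^ 2 * tau (I.M - 1) := by gcongr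
    rw [hB, hC]
    linarith [hI.ε_sq_mul_tau_le]
  have hBC' : B ≤ I.Cδ := le_trans (le_add_of_nonneg_left (by positivity)) hBC
  have hz := h.controlled hκ hBC
  have b1 := h.chowExcess_le hη hF hor hg hrun hκ hz (by linarith) hBC' hγp hI.two_le_M hθ
  have b2 := h.labelCount_le hF hor hg hrun hz hC1 hBC' hγp hI.γ_lt
    (by linarith [hI.two_le_M]) hθ
  rw [← hθdef] at b1 b2
  set L := Real.log (I.T / I.δ) with hLdef
  set l := Real.log I.T with hldef
  have hTn := hI.T_le_two_mul_tau
  have hT := hI.four_lt_T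
  have hn : (0 : ℝ) < tau (I.M - 1) := by linarith
  constructor
  · have k1 : 104 * I.β I.M / (tau (I.M - 1) * I.γ) ≤ 416 * (1 + I.c) * (I.ε * L) := by
      rw [div_le_iff₀ (by positivity)]
      have k2 : I.d ≤ I.ε * I.γ * (2 * tau (I.M - 1)) := by
        have : I.T * (I.ε * I.γ) = I.d := by
          unfold T
          field_simp
        rw [← this, mul_comm]
        gcongr
      have k3 : 2 * (1 + I.c) * (I.d * L) ≤
          2 * (1 + I.c) * (I.ε * I.γ * (2 * tau (I.M - 1)) * L) := by gcongr
      linarith [hI.β_M_le]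
    have k4 : 104 * I.β I.M / (tau (I.M - 1) * I.γ) * θ ≤ 416 * (1 + I.c) * (I.ε * L) * θ := by
      gcongr
    have k5 : I.ε ≤ I.ε * L * θ :=
      calc I.ε ≤ I.ε * L := le_mul_of_one_le_right hεp.le hL
        _ ≤ I.ε * L * θ := le_mul_of_one_le_right (by positivity) hθ1
    have k6 : I.ε * L * θ ≤ (1 + I.c) * (I.ε * L * θ) :=
      le_mul_of_one_le_left (by positivity) (by linarith)
    have k7 : 0 ≤ (1 + I.c) * (I.ε * L * θ) := by positivity
    linarith
  · have m1 : (I.M : ℝ) * I.β 1 ≤ 18 * (1 + I.c) * (I.d * L) * l ^ 2 := by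
      calc (I.M : ℝ) * I.β 1 ≤ I.M * (I.M * (2 * (1 + I.c) * (I.d * L))) := by
            gcongr; exact hI.β_one_le
        _ ≤ (3 * l) * ((3 * l) * (2 * (1 + I.c) * (I.d * L))) := by
            have := hI.M_le_log
            gcongr
        _ = _ := by ring
    have hd0 : 0 ≤ I.d / I.γ ^ 2 * l ^ 2 * L * θ := by positivity
    have m2 : 2 * (I.M * (104 * I.β 1 / I.γ ^ 2 * θ)) ≤
        3744 * (1 + I.c) * (I.d / I.γ ^ 2 * l ^ 2 * L * θ) := by
      calc 2 * (I.M * (104 * I.β 1 / I.γ ^ 2 * θ)) = 208 / I.γ ^ 2 * θ * (I.M * I.β 1) := by ring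
        _ ≤ 208 / I.γ ^ 2 * θ * (18 * (1 + I.c) * (I.d * L) * l ^ 2) := by gcongr
        _ = _ := by ring
    have m3 : I.Cδ ≤ (1 + I.c) * (I.d / I.γ ^ 2 * l ^ 2 * L * θ) := by
      have m4 : I.d * L ≤ I.d / I.γ ^ 2 * l ^ 2 * L * θ := by
        have a1 : I.d ≤ I.d / I.γ ^ 2 := by
          rw [le_div_iff₀ (by positivity)]
          exact mul_le_of_le_one_right (by linarith)
            (pow_le_one₀ hγp.le (by linarith [hI.γ_lt]))
        calc I.d * L = I.d * 1 * L * 1 := by ring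
          _ ≤ I.d / I.γ ^ 2 * l ^ 2 * L * θ := by
              gcongr
              exact one_le_pow₀ hl
      rw [hC]
      nlinarith
    have m5 : 0 ≤ (1 + I.c) * (I.d / I.γ ^ 2 * l ^ 2 * L * θ) := by positivity
    linarith

end Input

end AbstainAL

/-! ### Assembly. -/

theorem mainTheorem8 :
    ∃ c₀ : ℝ, 0 < c₀ ∧ ∀ c : ℝ, c₀ ≤ c → ∃ C : ℝ, 0 < C ∧
      ∀ (X : Type*) [MeasurableSpace X]
        (D : Measure (X × Bool)) [IsProbabilityMeasure D]
        (η : X → ℝ) (_ : AbstainAL.IsCondProb D η)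
        (F : Set (X → ℝ)) (_ : ∀ f ∈ F, Measurable f ∧ ∀ x, f x ∈ Set.Icc (0 : ℝ) 1)
        (_ : AbstainAL.PointwiseSeparable F)
        (d : ℕ) (_ : AbstainAL.pdim F = d) (_ : 1 ≤ d)
        (oracle : List (X × Bool) → X → ℝ) (_ : AbstainAL.IsRegressionOracle F oracle)
        (ε γ δ κ : ℝ) (_ : 0 < ε) (_ : ε < γ) (_ : γ < 1 / 2) (_ : 0 < δ) (_ : δ < 1)
        (fbar : X → ℝ) (_ : fbar ∈ F) (_ : ∀ x, |fbar x - η x| ≤ κ) (_ : κ ≤ ε)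
        (I : AbstainAL.Input X)
        (_ : I = { F := F, oracle := oracle, ε := ε, γ := γ, δ := δ, c := c })
        (_ : I.IsMeasurableRun),
        Measure.infinitePi (fun _ : ℕ => D)
          {z | ¬ (ENNReal.ofReal (AbstainAL.chowExcess D η γ (I.output z)) ≤
                    ENNReal.ofReal (C * (ε * Real.log (d / (ε * γ * δ)))) *
                      AbstainAL.valDisagreementSup F fbar (γ / 2) ∧
                  (I.labelCount z : ℝ≥0∞) ≤
                    ENNReal.ofReal (C * (d / γ ^ 2 * Real.log (d / (ε * γ)) ^ 2 *
                        Real.log (d / (ε * γ * δ)))) *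
                      AbstainAL.valDisagreementSup F fbar (γ / 2))} ≤
          ENNReal.ofReal (2 * δ) := by
  -- Any lower bound of at least 58 on `c` would do: it gives `c - 4 ≥ 54`, as `failure_le`
  -- requires.
  refine ⟨100, by norm_num, fun c hc => ⟨4000 * (1 + c), by linarith, ?_⟩⟩
  intro X _ D _ η hη F hF hsep d hd hd1 oracle hor ε γ δ κ hε hεγ hγ hδ hδ1 fbar hfbar hκ hκε I hI
    hrun
  have hId : I.d = d := by simp [AbstainAL.Input.d, hI, hd]
  have hadm : I.Admissible := by
    refine ⟨?_, ?_, ?_, ?_, ?_, ?_⟩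
    · rw [hId]; exact_mod_cast hd1
    all_goals subst hI; assumption
  have hT : I.T = d / (ε * γ) := by rw [AbstainAL.Input.T, hId, hI]
  have hTδ : I.T / I.δ = d / (ε * γ * δ) := by rw [hT, hI, div_div]
  have hF' : ∀ f ∈ I.F, Measurable f ∧ ∀ x, f x ∈ Set.Icc (0 : ℝ) 1 := by rw [hI]; exact hF
  have hfI : fbar ∈ I.F := by rw [hI]; exact hfbar
  have horI : AbstainAL.IsRegressionOracle I.F I.oracle := by rw [hI]; exact hor
  have hIε : I.ε = ε := by rw [hI]
  have hIγ : I.γ = γ := by rw [hI]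
  have hIc : I.c = c := by rw [hI]
  have hIδ : I.δ = δ := by rw [hI]
  have hIF : I.F = F := by rw [hI]
  have hdL := hadm.one_le_d_mul_log
  have hX : Nonempty (X × Bool) := by
    by_contra hne
    rw [not_nonempty_iff] at hne
    have := measure_univ (μ := D)
    simp [Set.eq_empty_of_isEmpty] at this
  have hκ0 : 0 ≤ κ := (abs_nonneg _).trans (hκ hX.some.1)
  set B := (I.c - 4) * (I.d * Real.log (I.T / I.δ)) with hB
  have hB54 : 54 * (I.d * Real.log (I.T / I.δ)) ≤ B := by
    rw [hB, hIc]
    gcongr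
    linarith
  refine le_trans (measure_mono ?_) ((AbstainAL.Input.measure_not_smallDeviations_le hη hF'
    (hIF ▸ hsep) (hIF ▸ hd) hfI hrun hadm.two_le_M (B := B) (by linarith)).trans
    ((hadm.failure_le hId.symm hB54).trans_eq (by rw [hIδ])))
  intro z hz hgood
  refine hz ?_
  have hL := hadm.one_le_log
  have hl := hadm.one_le_log_T
  rw [← hTδ, ← hT]
  have hd0 : (0 : ℝ) < d := by exact_mod_cast hd1
  have hγ0 : 0 < γ := hε.trans hεγ
  have hc0 : 0 < 4000 * (1 + c) := by linarith
  -- With an infinite coefficient both bounds are infinite, since the factors in front are positive.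
  by_cases hθ : AbstainAL.valDisagreementSup F fbar (γ / 2) = ⊤
  · rw [hθ, ENNReal.mul_top, ENNReal.mul_top]
    · exact ⟨le_top, le_top⟩
    · rw [Ne, ENNReal.ofReal_eq_zero, not_le]
      positivity
    · rw [Ne, ENNReal.ofReal_eq_zero, not_le]
      positivity
  · have hb := hgood.bounds hadm hη hF' horI hfI hrun hκ hκ0 (hIε ▸ hκε) (by linarith) hB
      (by rw [hIF, hIγ]; exact hθ)
    rw [hIε, hIγ, hIc, hIF, hId] at hb
    rw [← ENNReal.ofReal_toReal hθ, ← ENNReal.ofReal_mul (by positivity),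
      ← ENNReal.ofReal_mul (by positivity), ← ENNReal.ofReal_natCast]
    exact ⟨ENNReal.ofReal_le_ofReal hb.1, ENNReal.ofReal_le_ofReal hb.2⟩
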